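/- In the market share ranking problem, the input consists of $n \ge 1$ products with preference weights $w_1,\dots,w_n \ge 0$, and of $K$ customer segments with proportions $\theta_1,\dots,\theta_K \ge 0$, $\sum_k \theta_k = 1$, and reservation prices $r^k_1 \ge \cdots \ge r^k_n$ for every $k \in [K]$. For a bijection (an assignment) $\mathcal{A} : [n] \to [n]$ from positions to products, let $s_k^{\mathcal{A}}$ be the minimal position $p$ with $\sum_{q \le p} w_{\mathcal{A}(q)} \ge r^k_p$ (and $s_k^{\mathcal{A}} = n$ if there is none), let $W_k(\mathcal{A}) = \sum_{q \le s_k^{\mathcal{A}}} w_{\mathcal{A}(q)}$, and let $M(\mathcal{A}) = \sum_{k \in [K]} \theta_k \cdot \frac{W_k(\mathcal{A})}{1 + W_k(\mathcal{A})}$ be the expected market share of $\mathcal{A}$. Let $\mathrm{OPT} = \max_{\mathcal{A}} M(\mathcal{A})$. **Theorem.** For every $\epsilon > 0$ there is an algorithm (a real RAM program: unit-cost arithmetic and comparisons of real numbers, rational constants, no floor function) that, given any such instance, computes an assignment $\mathcal{A}$ with $M(\mathcal{A}) \ge (1-\epsilon) \cdot \mathrm{OPT}$ in time $O(K \cdot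 n^{O(\frac{1}{\epsilon^6} \log \frac{1}{\epsilon})})$. More precisely, there is an absolute constant $C > 0$ such that, for every $\epsilon > 0$, the number of elementary operations is at most $C \cdot K \cdot n^{C \cdot \max\{1,\ \epsilon^{-6} \ln (1/\epsilon)\}}$ on every instance. -/

import Mathlib

/-! ## The market share ranking problem -/

/-- An instance of market share ranking: `n ≥ 1` products with preference weights `w`, and `K`
customer segments with proportions `θ` and position-dependent, weakly decreasing reservation
prices `r k`. Products, positions and segments are indexed from `0`. -/
structure Market where
  n : ℕ
  K : ℕ
  n_pos : 0 < n
  w : Fin n → ℝ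
  θ : Fin K → ℝ
  r : Fin K → Fin n → ℝ
  w_nonneg : ∀ i, 0 ≤ w i
  θ_nonneg : ∀ k, 0 ≤ θ k
  θ_sum : ∑ k, θ k = 1
  r_antitone : ∀ k, Antitone (r k)

namespace Market

/-- A position-to-product assignment; `A p` is the product placed at position `p`. -/
abbrev Assignment (I : Market) : Type := Equiv.Perm (Fin I.n)

/-- The total preference weight of a set of products. -/
noncomputable def weight (I : Market) (S : Finset (Fin I.n)) : ℝ := ∑ i ∈ S, I.w i

/-- The set of products placed at the positions up to and including `p`. -/
def placed (I : Market) (A : I.Assignment) (p : Fin I.n) : Finset (Fin I.n) :=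
  (Finset.Iic p).image A

/-- The positions at which the total weight inspected so far reaches the reservation price. -/
noncomputable def stopCandidates (I : Market) (A : I.Assignment) (k : Fin I.K) :
    Finset (Fin I.n) :=
  {p | I.r k p ≤ I.weight (I.placed A p)}

/-- The stopping point of segment `k`: the first position at which the total weight inspected so
far reaches the reservation price of that position, and the last position if there is none. -/
noncomputable def stopPos (I : Market) (A : I.Assignment) (k : Fin I.K) : Fin I.n :=
  if h : (I.stopCandidates A k).Nonempty then (I.stopCandidates A k).min' h
  else ⟨I.n - 1, Nat.sub_lt I.n_pos Nat.one_pos⟩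

/-- The consideration set of segment `k`. -/
noncomputable def considered (I : Market) (A : I.Assignment) (k : Fin I.K) :
    Finset (Fin I.n) :=
  I.placed A (I.stopPos A k)

/-- The market share `M_k(A)`: the probability that a customer of segment `k`, choosing from her
consideration set by the multinomial logit model, makes a purchase. -/
noncomputable def segmentShare (I : Market) (A : I.Assignment) (k : Fin I.K) : ℝ :=
  I.weight (I.considered A k) / (1 + I.weight (I.considered A k))

/-- The expected market share `M(A)`. -/
noncomputable def share (I : Market) (A : I.Assignment) : ℝ :=
  ∑ k, I.θ k * I.segmentShare A k

/-- The maximum of the expected market share over all assignments. -/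
noncomputable def opt (I : Market) : ℝ :=
  (Finset.univ : Finset I.Assignment).sup' Finset.univ_nonempty I.share

end Market

/-! ## Real RAM programs and their running time

Memory consists of arrays of natural numbers and arrays of real numbers. A program mentions
finitely many arrays by name, and its cells are addressed by computed natural numbers. Natural
numbers can be added, subtracted (truncated at `0`) and compared; real numbers can be added,
subtracted, multiplied, divided and compared. There is no conversion of reals to natural numbers
(no floor), and the constants in a program are rational. -/

/-- Memory: `nat a i` and `real a i` are the cells with index `i` of the arrays named `a`. -/
structure Mem where
  nat : ℕ → ℕ → ℕ
  real : ℕ → ℕ → ℝ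

/-- Natural-number expressions. -/
inductive NatExpr where
  | lit (c : ℕ)
  | get (a : ℕ) (i : NatExpr)
  | add (e f : NatExpr)
  | sub (e f : NatExpr)

/-- Real-number expressions. -/
inductive RealExpr where
  | lit (c : ℚ)
  | get (a : ℕ) (i : NatExpr)
  | ofNat (e : NatExpr)
  | add (e f : RealExpr)
  | sub (e f : RealExpr)
  | mul (e f : RealExpr)
  | div (e f : RealExpr)

/-- Tests for branching. -/
inductive BoolExpr where
  | natLe (e f : NatExpr)
  | realLe (e f : RealExpr)
  | not (b : BoolExpr)
  | and (b c : BoolExpr)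

/-- Programs. -/
inductive Prog where
  | skip
  | setNat (a : ℕ) (i e : NatExpr)
  | setReal (a : ℕ) (i : NatExpr) (e : RealExpr)
  | seq (P Q : Prog)
  | ite (b : BoolExpr) (P Q : Prog)
  | loop (b : BoolExpr) (P : Prog)

def NatExpr.eval (m : Mem) : NatExpr → ℕ
  | .lit c => c
  | .get a i => m.nat a (i.eval m)
  | .add e f => e.eval m + f.eval m
  | .sub e f => e.eval m - f.eval m

noncomputable def RealExpr.eval (m : Mem) : RealExpr → ℝ
  | .lit c => (c : ℝ)
  | .get a i => m.real a (i.eval m)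
  | .ofNat e => ((e.eval m : ℕ) : ℝ)
  | .add e f => e.eval m + f.eval m
  | .sub e f => e.eval m - f.eval m
  | .mul e f => e.eval m * f.eval m
  | .div e f => e.eval m / f.eval m

def BoolExpr.holds (m : Mem) : BoolExpr → Prop
  | .natLe e f => e.eval m ≤ f.eval m
  | .realLe e f => e.eval m ≤ f.eval m
  | .not b => ¬ b.holds m
  | .and b c => b.holds m ∧ c.holds m

/-- The number of elementary operations in the evaluation of an expression: one for every
constant, memory access, conversion and arithmetic operation. -/
def NatExpr.cost : NatExpr → ℕ
  | .lit _ => 1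
  | .get _ i => i.cost + 1
  | .add e f => e.cost + f.cost + 1
  | .sub e f => e.cost + f.cost + 1

def RealExpr.cost : RealExpr → ℕ
  | .lit _ => 1
  | .get _ i => i.cost + 1
  | .ofNat e => e.cost + 1
  | .add e f => e.cost + f.cost + 1
  | .sub e f => e.cost + f.cost + 1
  | .mul e f => e.cost + f.cost + 1
  | .div e f => e.cost + f.cost + 1

def BoolExpr.cost : BoolExpr → ℕ
  | .natLe e f => e.cost + f.cost + 1
  | .realLe e f => e.cost + f.cost + 1
  | .not b => b.cost + 1
  | .and b c => b.cost + c.cost + 1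

/-- The memory after cell `i` of the natural-number array `a` has been overwritten by `x`. -/
def Mem.setNat (m : Mem) (a i x : ℕ) : Mem where
  nat := fun b j => if b = a ∧ j = i then x else m.nat b j
  real := m.real

/-- The memory after cell `i` of the real array `a` has been overwritten by `x`. -/
noncomputable def Mem.setReal (m : Mem) (a i : ℕ) (x : ℝ) : Mem where
  nat := m.nat
  real := fun b j => if b = a ∧ j = i then x else m.real b j

/-- `P.Run m m' t`: started in memory `m`, the program `P` halts in memory `m'`, having executed
`t` elementary operations (every executed command and every evaluated test counts one, in addition
to the operations needed to evaluate the expressions in it). -/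
inductive Prog.Run : Prog → Mem → Mem → ℕ → Prop
  | skip (m : Mem) : Prog.Run .skip m m 1
  | setNat (m : Mem) (a : ℕ) (i e : NatExpr) :
      Prog.Run (.setNat a i e) m (m.setNat a (i.eval m) (e.eval m)) (i.cost + e.cost + 1)
  | setReal (m : Mem) (a : ℕ) (i : NatExpr) (e : RealExpr) :
      Prog.Run (.setReal a i e) m (m.setReal a (i.eval m) (e.eval m)) (i.cost + e.cost + 1)
  | seq {P Q : Prog} {m m' m'' : Mem} {s t : ℕ} :
      Prog.Run P m m' s → Prog.Run Q m' m'' t → Prog.Run (.seq P Q) m m'' (s + t)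
  | ite_true {b : BoolExpr} {P Q : Prog} {m m' : Mem} {t : ℕ} :
      b.holds m → Prog.Run P m m' t → Prog.Run (.ite b P Q) m m' (b.cost + 1 + t)
  | ite_false {b : BoolExpr} {P Q : Prog} {m m' : Mem} {t : ℕ} :
      ¬ b.holds m → Prog.Run Q m m' t → Prog.Run (.ite b P Q) m m' (b.cost + 1 + t)
  | loop_true {b : BoolExpr} {P : Prog} {m m' m'' : Mem} {s t : ℕ} :
      b.holds m → Prog.Run P m m' s → Prog.Run (.loop b P) m' m'' t →
      Prog.Run (.loop b P) m m'' (b.cost + 1 + s + t)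
  | loop_false {b : BoolExpr} {P : Prog} {m : Mem} :
      ¬ b.holds m → Prog.Run (.loop b P) m m (b.cost + 1)

/-- Programs are deterministic: the final memory and the number of operations are determined by
the program and the initial memory. -/
theorem Prog.Run.deterministic {P : Prog} {m m₁ : Mem} {t₁ : ℕ} (h₁ : P.Run m m₁ t₁) :
    ∀ {m₂ : Mem} {t₂ : ℕ}, P.Run m m₂ t₂ → m₁ = m₂ ∧ t₁ = t₂ := by
  induction h₁ with
  | skip m => intro m₂ t₂ h₂; cases h₂; exact ⟨rfl, rfl⟩
  | setNat m a i e => intro m₂ t₂ h₂; cases h₂; exact ⟨rfl, rfl⟩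
  | setReal m a i e => intro m₂ t₂ h₂; cases h₂; exact ⟨rfl, rfl⟩
  | seq _ _ ih ih' =>
    intro m₂ t₂ h₂
    cases h₂ with
    | seq h h' =>
      obtain ⟨rfl, rfl⟩ := ih h
      obtain ⟨rfl, rfl⟩ := ih' h'
      exact ⟨rfl, rfl⟩
  | ite_true hb _ ih =>
    intro m₂ t₂ h₂
    cases h₂ with
    | ite_true _ h => obtain ⟨rfl, rfl⟩ := ih h; exact ⟨rfl, rfl⟩
    | ite_false hb' _ => exact absurd hb hb'
  | ite_false hb _ ih =>
    intro m₂ t₂ h₂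
    cases h₂ with
    | ite_true hb' _ => exact absurd hb' hb
    | ite_false _ h => obtain ⟨rfl, rfl⟩ := ih h; exact ⟨rfl, rfl⟩
  | loop_true hb _ _ ih ih' =>
    intro m₂ t₂ h₂
    cases h₂ with
    | loop_true _ h h' =>
      obtain ⟨rfl, rfl⟩ := ih h
      obtain ⟨rfl, rfl⟩ := ih' h'
      exact ⟨rfl, rfl⟩
    | loop_false hb' => exact absurd hb hb'
  | loop_false hb =>
    intro m₂ t₂ h₂
    cases h₂ with
    | loop_true hb' _ _ => exact absurd hb' hb
    | loop_false _ => exact ⟨rfl, rfl⟩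

/-! ## Input and output -/

namespace Market

/-- The initial memory: natural-number array `0` holds `n` and `K` in cells `0` and `1`; real
array `0` holds the weights, real array `1` the proportions, and real array `2` the reservation
prices, row by row. All other cells are `0`. -/
noncomputable def input (I : Market) : Mem where
  nat := fun a i => if a = 0 ∧ i = 0 then I.n else if a = 0 ∧ i = 1 then I.K else 0
  real := fun a i =>
    if a = 0 then (if h : i < I.n then I.w ⟨i, h⟩ else 0)
    else if a = 1 then (if h : i < I.K then I.θ ⟨i, h⟩ else 0)
    else if a = 2 then
      (if h : i / I.n < I.K then I.r ⟨i / I.n, h⟩ ⟨i % I.n, Nat.mod_lt i I.n_pos⟩ else 0)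
    else 0

/-- The program `P` computes the assignment `A` for the instance `I` in `t` operations: it halts,
and cell `p` of natural-number array `1` then holds the product placed at position `p`. -/
def Computes (I : Market) (P : Prog) (A : I.Assignment) (t : ℕ) : Prop :=
  ∃ m : Mem, P.Run I.input m t ∧ ∀ p : Fin I.n, m.nat 1 (p : ℕ) = (A p : ℕ)

end Market

/-!
The program sorts the products by decreasing weight and tries polynomially many assignments. Each
is encoded by a list of `codeCount e = O(1 / e⁴)` pairs `(m, a)`, where
`e = min ε (1 / 2) / 6`: reading the list, the pair `(m, a)` takes the contiguous block of `m` products that starts at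
index `a` of the sorted list of products not placed yet, and appends it to the ranking
(`arrange`). What is left at the end follows in sorted order. There are `n ^ O(1 / e⁴)` such lists,
each one costs `O(K n²)` operations up to a factor depending on `e` (absorbed by the exponent,
as `n ≥ 2`), and the best assignment found is kept.

Why one of these assignments, `B`, is nearly as good as an optimal one, `A`: let `M` be the largest
weight and `u = min M 1`. Cut `A` into `2T` blocks, `T = ⌈1 / e²⌉`, each being a single product or of
weight at most `e * u`, followed by a tail, so that the blocks together weigh at least `u / e` unless
the tail is empty (`exists_blocks`). Suppose that at every block end the weight placed by `B` is at
most the weight placed by `A`, and short of it by at most `e * u`. Reservation prices decrease along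
the ranking, so a customer who walks past a block end in `A` walks past it in `B`
(`StopsAt.le_of_le`). Hence a customer who stops inside a block in `A` inspects in `B` a weight
smaller by at most `2 * e * u`. A customer who stops in the tail inspects in `B` at least about
`u / e`; against this either the weight `M ≤ u` of one more product is negligible, or the market
share is nearly `1` already (`customer_le`). The additive losses are paid by
`opt ≥ M / (1 + M) ≥ u / 2`.

Such a `B` exists among the arrangements (`Mimics.blocks`): a product heavier than
`δ = e * u / (2 * T)` is taken by a pair of its own, and there are at most `2T` of those in a block.
The light products of a block are replaced by a window of equally many consecutive light products
in the sorted list of the remaining ones. Sliding a window by one index changes its weight by at most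
`δ`, so a window of nearly the right weight exists. Taking a *contiguous* window leaves the
remaining products at least as spread out as those that remain in `A`, up to an error that grows by
`δ` per block, which keeps the procedure going (`Tracks.window`).

The running time is derived in a Hoare-style calculus, `Prog.Spec`, with one rule per command, a rule
for counting loops and a frame rule.
-/

/-! ### Arrangements encoded by few numbers -/

/-- Moves the element with index `a` of the second list (the sorted list of remaining weights) to the
end of the first one (the weights placed so far). Nothing happens if there is no such element. -/
def extract (a : ℕ) (s : List ℝ × List ℝ) : List ℝ × List ℝ :=
  (s.1 ++ (s.2[a]?).toList, s.2.eraseIdx a)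

/-- Executes a list of codes; the code `(m, a)` stands for `m` repetitions of `extract a`, that is, for
moving the `m` consecutive remaining elements that start at index `a`. -/
def arrange (cs : List (ℕ × ℕ)) (s : List ℝ × List ℝ) : List ℝ × List ℝ :=
  cs.foldl (fun s c => (extract c.2)^[c.1] s) s

theorem arrange_nil (s : List ℝ × List ℝ) : arrange [] s = s := rfl

theorem arrange_cons (c : ℕ × ℕ) (cs : List (ℕ × ℕ)) (s : List ℝ × List ℝ) :
    arrange (c :: cs) s = arrange cs ((extract c.2)^[c.1] s) := rfl

theorem arrange_append (cs cs' : List (ℕ × ℕ)) (s : List ℝ × List ℝ) :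
    arrange (cs ++ cs') s = arrange cs' (arrange cs s) := List.foldl_append

theorem arrange_replicate_zero (k : ℕ) (s : List ℝ × List ℝ) :
    arrange (List.replicate k (0, 0)) s = s := by
  induction k with
  | zero => rfl
  | succ k ih => rw [List.replicate_succ, arrange_cons]; exact ih

/-- Removing an element shifts its successors, so that repeated extraction at one index moves a
contiguous block. -/
theorem iterate_extract (o X V Y : List ℝ) :
    (extract X.length)^[V.length] (o, X ++ V ++ Y) = (o ++ V, X ++ Y) := by
  induction V generalizing o with
  | nil => simp
  | cons v V ih =>
    have h : extract X.length (o, X ++ v :: V ++ Y) = (o ++ [v], X ++ V ++ Y) := by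
      simp [extract, List.eraseIdx_append_of_length_le]
    rw [List.length_cons, Function.iterate_succ_apply, h, ih]
    simp

theorem prefix_iterate_extract (a m : ℕ) (s : List ℝ × List ℝ) : s.1 <+: ((extract a)^[m] s).1 := by
  induction m generalizing s with
  | zero => simp
  | succ m ih =>
    rw [Function.iterate_succ_apply]
    exact (List.prefix_append _ _).trans (ih (extract a s))

theorem prefix_arrange (cs : List (ℕ × ℕ)) (s : List ℝ × List ℝ) : s.1 <+: (arrange cs s).1 := by
  induction cs generalizing s with
  | nil => simp [arrange_nil]
  | cons c cs ih => rw [arrange_cons]; exact (prefix_iterate_extract _ _ _).trans (ih _)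

/-! ### Extremal sums in sorted lists -/

theorem sum_le_sum_take_of_sublist {l z : List ℝ} (hl : l.Pairwise (· ≥ ·)) (hz : z.Sublist l) :
    z.sum ≤ (l.take z.length).sum := by
  induction l generalizing z with
  | nil => simp_all
  | cons x l ih =>
    cases z with
    | nil => simp
    | cons y z =>
      have hy : y ≤ x := by
        rcases List.mem_cons.1 (hz.subset List.mem_cons_self) with h | h
        · exact h.le
        · exact List.rel_of_pairwise_cons hl h
      have := ih hl.of_cons hz.tail
      simp only [List.sum_cons, List.length_cons, List.take_succ_cons]
      exact add_le_add hy this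

theorem sum_le_sum_take {l : List ℝ} {Z : Multiset ℝ} (hl : l.Pairwise (· ≥ ·))
    (hZ : Z ≤ (l : Multiset ℝ)) : Z.sum ≤ (l.take Z.card).sum := by
  induction Z using Quotient.inductionOn with
  | _ z =>
    obtain ⟨z', hz', hs⟩ := (Multiset.coe_le.1 hZ : z.Subperm l)
    have := sum_le_sum_take_of_sublist hl hs
    simpa [hz'.sum_eq, hz'.length_eq] using this

theorem sum_drop_le_sum {l : List ℝ} {Z : Multiset ℝ} (hl : l.Pairwise (· ≥ ·))
    (hZ : Z ≤ (l : Multiset ℝ)) : (l.drop (l.length - Z.card)).sum ≤ Z.sum := by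
  obtain ⟨Y, hY⟩ := Multiset.le_iff_exists_add.1 hZ
  have hY' : Y ≤ (l : Multiset ℝ) := hY ▸ Multiset.le_add_left _ _
  have h := sum_le_sum_take hl hY'
  have hc : l.length - Z.card = Y.card := by
    have := congrArg Multiset.card hY
    simp at this; omega
  have hs := congrArg Multiset.sum hY
  have := List.sum_take_add_sum_drop l Y.card
  simp only [Multiset.sum_coe, Multiset.sum_add] at hs
  rw [hc]; linarith

/-! ### Replacing light products by windows -/

/-- The list `R` of light weights remaining in the new ranking may stand in for the multiset `Q` of light
weights remaining in the given one: it is at least as spread out, up to an error. Here `d` is the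
weight by which the new ranking is behind so far, and `s` bounds the accumulated error. The sum of
the first (last) `t` elements of `R` is compared with *every* sub-multiset of `Q` of cardinality `t`. -/
structure Tracks (R : List ℝ) (Q : Multiset ℝ) (s d : ℝ) : Prop where
  length_eq : R.length = Q.card
  nonneg : 0 ≤ d
  le : d ≤ s
  top : ∀ Z ≤ Q, Z.sum ≤ (R.take Z.card).sum + (s - d)
  bot : ∀ Z ≤ Q, (R.drop (R.length - Z.card)).sum ≤ Z.sum + d

theorem Tracks.refl {R : List ℝ} {Q : Multiset ℝ} (hR : R.Pairwise (· ≥ ·)) (h : (R : Multiset ℝ) = Q) :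
    Tracks R Q 0 0 where
  length_eq := by rw [← h]; simp
  nonneg := le_rfl
  le := le_rfl
  top Z hZ := by simpa using sum_le_sum_take hR (h ▸ hZ)
  bot Z hZ := by simpa using sum_drop_le_sum hR (h ▸ hZ)

/-- A discrete intermediate value theorem: take the first window that is light enough. -/
theorem exists_window {R : List ℝ} {δ U : ℝ} {m : ℕ} (hm : m ≤ R.length)
    (hR : ∀ x ∈ R, 0 ≤ x ∧ x ≤ δ) :
    ∃ a, a + m ≤ R.length ∧
      (((R.drop a).take m).sum ≤ U ∨ a + m = R.length) ∧
      (U - δ ≤ ((R.drop a).take m).sum ∨ a = 0) := by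
  classical
  have hex : ∃ a, ((R.drop a).take m).sum ≤ U ∨ a + m = R.length :=
    ⟨R.length - m, Or.inr (by omega)⟩
  have hle : Nat.find hex ≤ R.length - m := Nat.find_min' hex (Or.inr (by omega))
  refine ⟨Nat.find hex, by omega, Nat.find_spec hex, ?_⟩
  by_cases h0 : Nat.find hex = 0
  · exact Or.inr h0
  left
  obtain ⟨b, hb⟩ := Nat.exists_eq_succ_of_ne_zero h0
  rw [hb] at hle ⊢
  have hmin := Nat.find_min hex (m := b) (by omega)
  push Not at hmin
  have hb' : b < R.length := by omega
  have e1 : R.drop b = R[b] :: R.drop (b + 1) := List.drop_eq_getElem_cons hb'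
  have h1 := hmin.1
  rw [e1] at h1
  have hx := (hR _ (List.getElem_mem hb')).2
  cases m with
  | zero => simp at h1 ⊢; linarith [(hR _ (List.getElem_mem hb')).1]
  | succ m =>
    rw [List.take_succ_cons, List.sum_cons] at h1
    have e2 : ((R.drop (b + 1)).take (m + 1)).sum
        = ((R.drop (b + 1)).take m).sum + R[b + 1 + m]'(by omega) := by
      rw [List.take_succ_eq_append_getElem (by simp; omega)]
      simp
    have hy := (hR _ (List.getElem_mem (show b + 1 + m < R.length by omega))).1
    rw [Nat.succ_eq_add_one, e2]; linarith

/-- When `U` leaves `Q`, some contiguous window of `R` with equally many elements may leave `R`. A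
window sum below `U.sum` increases the lag `d`, and only a window at the end of `R` can decrease it;
this is what the two bounds on partial sums of the rest of `R` need. -/
theorem Tracks.window {R : List ℝ} {Q U : Multiset ℝ} {s d δ : ℝ} (h : Tracks R Q s d)
    (hR : ∀ x ∈ R, 0 ≤ x ∧ x ≤ δ) (hδ : 0 ≤ δ) (hU : U ≤ Q) :
    ∃ a d', a + U.card ≤ R.length ∧
      ((R.drop a).take U.card).sum + d' = U.sum + d ∧
      Tracks (R.take a ++ R.drop (a + U.card)) (Q - U) (s + δ) d' := by
  have hUQ := Multiset.card_le_card hU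
  have hlen := h.length_eq
  obtain ⟨a, ha, hv, hv'⟩ := exists_window (U := U.sum) (m := U.card) (by omega) hR
  have hsplit : (R.take a).sum + ((R.drop a).take U.card).sum + (R.drop (a + U.card)).sum
      = R.sum := by
    have e1 := List.sum_take_add_sum_drop R a
    have e2 := List.sum_take_add_sum_drop (R.drop a) U.card
    rw [List.drop_drop] at e2
    linarith
  set v := ((R.drop a).take U.card).sum with hvdef
  have hbot := h.bot U hU
  have htop := h.top U hU
  have h0 := h.nonneg
  have h1 := h.le
  have hvU : v ≤ U.sum + d := by
    rcases hv with hv | hv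
    · linarith
    · have : R.drop (R.length - U.card) = (R.drop a).take U.card := by
        rw [show R.length - U.card = a by omega, List.take_of_length_le (by simp; omega)]
      rw [this] at hbot; exact hbot
  have hvl : U.sum + d - v ≤ s + δ := by
    rcases hv' with hv' | hv'
    · linarith
    · subst hv'
      simp only [List.drop_zero] at hvdef
      rw [← hvdef] at htop; linarith
  refine ⟨a, U.sum + d - v, ha, by ring, ?_, by linarith, hvl, ?_, ?_⟩
  · simp [Multiset.card_sub hU]; omega
  · intro Z hZ
    have hZc : Z.card + U.card ≤ Q.card := by
      have := Multiset.card_le_card hZ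
      rw [Multiset.card_sub hU] at this; omega
    have hZQ : Z + U ≤ Q := by
      calc Z + U ≤ Q - U + U := by gcongr
        _ = Q := tsub_add_cancel_of_le hU
    -- The first `Z.card` elements of the rest end before the window, or else they make up, together
    -- with the window, the first `Z.card + U.card` elements of `R`.
    rcases lt_or_ge Z.card a with hlt | hge
    · have hst := h.top Z (le_trans (Multiset.le_add_right _ _) hZQ)
      have e : (R.take a ++ R.drop (a + U.card)).take Z.card = R.take Z.card := by
        rw [List.take_append_of_le_length (by simp; omega), List.take_take, min_eq_left hlt.le]
      rw [e]
      rcases hv' with hv' | hv'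
      · linarith
      · omega
    · have hst := h.top _ hZQ
      have e : ((R.take a ++ R.drop (a + U.card)).take Z.card).sum + v
          = (R.take (Z.card + U.card)).sum := by
        have e1 : R.take (Z.card + U.card) = R.take a ++ ((R.drop a).take U.card ++
            (R.drop (a + U.card)).take (Z.card - a)) := by
          rw [show Z.card + U.card = a + (U.card + (Z.card - a)) by omega, List.take_add,
            List.take_add, List.drop_drop]
        rw [e1, List.take_append, List.take_of_length_le (by simp; omega)]
        simp only [List.sum_append, List.length_take]
        rw [min_eq_left (by omega)]
        ring
      simp only [Multiset.card_add, Multiset.sum_add] at hst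
      linarith
  · intro Z hZ
    have hZc : Z.card + U.card ≤ Q.card := by
      have := Multiset.card_le_card hZ
      rw [Multiset.card_sub hU] at this; omega
    have hZQ : Z + U ≤ Q := by
      calc Z + U ≤ Q - U + U := by gcongr
        _ = Q := tsub_add_cancel_of_le hU
    have hl : (R.take a ++ R.drop (a + U.card)).length = R.length - U.card := by
      simp; omega
    rw [hl, List.drop_append]
    simp only [List.length_take, List.drop_drop]
    rw [min_eq_left (by omega)]
    rcases le_or_gt (a + U.card + Z.card) R.length with hle | hgt
    · have hst := h.bot Z (le_trans (Multiset.le_add_right _ _) hZQ)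
      rw [List.drop_of_length_le (by simp; omega), List.nil_append,
        show a + U.card + (R.length - U.card - Z.card - a) = R.length - Z.card by omega]
      rcases hv with hv | hv
      · linarith
      · have hZ0 : Z = 0 := Multiset.card_eq_zero.1 (by omega)
        subst hZ0; simp; linarith
    · have hst := h.bot _ hZQ
      have e1 := List.sum_take_add_sum_drop R (R.length - (Z + U).card)
      have e2 := List.sum_take_add_sum_drop (R.take a) (R.length - U.card - Z.card)
      rw [List.take_take, min_eq_left (by omega),
        show R.length - U.card - Z.card = R.length - (Z + U).card by simp; omega] at e2
      rw [show R.length - U.card - Z.card = R.length - (Z + U).card by simp; omega,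
        show R.length - (Z + U).card - a = 0 by simp; omega]
      simp only [List.sum_append, Multiset.sum_add, add_zero] at hst ⊢
      linarith

/-- The state `st` of a new ranking (weights placed, sorted weights remaining) mimics a given ranking, of
which the part `p` has been placed and `q` remains: the same weights above `δ` remain, and the
remaining weights up to `δ` satisfy `Tracks`. -/
structure Mimics (δ s : ℝ) (p q : List ℝ) (st : List ℝ × List ℝ) : Prop where
  length_eq : st.1.length = p.length
  sorted : st.2.Pairwise (· ≥ ·)
  nonneg : ∀ x ∈ st.2, 0 ≤ x
  split : ∃ Rb Rs d, st.2 = Rb ++ Rs ∧ Rb.Perm (q.filter (δ < ·)) ∧ (∀ x ∈ Rs, x ≤ δ) ∧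
    Tracks Rs (q.filter (¬ δ < ·) : List ℝ) s d ∧ st.1.sum + d = p.sum

theorem Mimics.sum_le {δ s : ℝ} {p q : List ℝ} {st : List ℝ × List ℝ} (h : Mimics δ s p q st) :
    st.1.sum ≤ p.sum ∧ p.sum - s ≤ st.1.sum := by
  obtain ⟨Rb, Rs, d, -, -, -, ht, hd⟩ := h.split
  have := ht.nonneg
  have := ht.le
  constructor <;> linarith

theorem Mimics.length_snd {δ s : ℝ} {p q : List ℝ} {st : List ℝ × List ℝ}
    (h : Mimics δ s p q st) : st.2.length = q.length := by
  obtain ⟨Rb, Rs, d, h1, h2, -, ht, -⟩ := h.split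
  have e1 := h2.length_eq
  have e2 := ht.length_eq
  have e3 := List.length_eq_length_filter_add (l := q) (δ < ·)
  rw [h1, List.length_append, e1, e2, e3]
  simp only [Multiset.coe_card, decide_not]

/-- Continuing with the remaining weights in sorted order, the new ranking is never behind the given one
by more than `s`. -/
theorem Mimics.sum_take_le {δ s : ℝ} {p q : List ℝ} {st : List ℝ × List ℝ}
    (h : Mimics δ s p q st) (t : ℕ) (ht : t ≤ q.length) :
    p.sum + (q.take t).sum ≤ st.1.sum + (st.2.take t).sum + s := by
  obtain ⟨Rb, Rs, d, h1, h2, -, htr, hd⟩ := h.split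
  have hsort := h.sorted
  set Zb := (q.take t).filter (δ < ·) with hZb
  set Zs := (q.take t).filter (¬ δ < ·) with hZs
  have hsum : (q.take t).sum = Zb.sum + Zs.sum := by
    have := (List.filter_append_perm (fun x => decide (δ < x)) (q.take t)).sum_eq
    rw [List.sum_append] at this
    simp only [hZb, hZs, ← this, decide_not]
  have hlen : Zb.length + Zs.length = t := by
    have := (List.filter_append_perm (fun x => decide (δ < x)) (q.take t)).length_eq
    rw [List.length_append, List.length_take, min_eq_left ht] at this
    simpa only [hZb, hZs, decide_not] using this
  have hsb : Zb.Subperm Rb :=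
    (((List.take_sublist t q).filter _).subperm).trans h2.symm.subperm
  have hss : (Zs : Multiset ℝ) ≤ (q.filter (¬ δ < ·) : List ℝ) :=
    Multiset.coe_le.2 ((List.take_sublist t q).filter _).subperm
  have b1 : Zb.sum ≤ (Rb.take Zb.length).sum := by
    have := sum_le_sum_take (l := Rb) (Z := (Zb : Multiset ℝ))
      ((h1 ▸ hsort).sublist (List.sublist_append_left _ _)) (Multiset.coe_le.2 hsb)
    simpa using this
  have b2 : Zs.sum ≤ (Rs.take Zs.length).sum + (s - d) := by simpa using htr.top _ hss
  have hlb := hsb.length_le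
  have hls : Zs.length ≤ Rs.length := by
    have := Multiset.card_le_card hss
    rw [← htr.length_eq] at this; simpa using this
  have b3 := sum_le_sum_take_of_sublist (l := Rb ++ Rs) (h1 ▸ hsort)
    ((List.take_sublist Zb.length Rb).append (List.take_sublist Zs.length Rs))
  rw [List.sum_append, List.length_append, List.length_take, List.length_take,
    min_eq_left hlb, min_eq_left hls, hlen, ← h1] at b3
  linarith

theorem Mimics.init {δ : ℝ} {l A : List ℝ} (hl : l.Pairwise (· ≥ ·)) (hA : l.Perm A)
    (h0 : ∀ x ∈ l, 0 ≤ x) : Mimics δ 0 [] A ([], l) where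
  length_eq := rfl
  sorted := hl
  nonneg := h0
  split := by
    have hperm := List.filter_append_perm (fun x => decide (δ < x)) l
    refine ⟨l.filter (δ < ·), l.filter (¬ δ < ·), 0, ?_, hA.filter _, ?_, ?_, by simp⟩
    · clear hA h0 hperm
      induction l with
      | nil => simp
      | cons x l ih =>
        have ih := ih hl.of_cons
        by_cases hx : δ < x
        · simpa [List.filter_cons, hx] using ih
        · have h1 : l.filter (δ < ·) = [] := by
            rw [List.filter_eq_nil_iff]
            intro y hy
            have := List.rel_of_pairwise_cons hl hy
            simp; linarith
          rw [h1] at ih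
          have hx' : x ≤ δ := not_lt.1 hx
          simp only [not_lt, List.nil_append, List.filter_cons, decide_eq_true hx', if_true, hx,
            decide_false, Bool.false_eq_true, if_false, h1] at ih ⊢
          rw [← ih]
    · intro x hx
      have := (List.mem_filter.1 hx).2
      simpa using this
    · exact Tracks.refl (hl.sublist List.filter_sublist) (Multiset.coe_eq_coe.2 (hA.filter _))

/-- The heavy weights `X` can be extracted one by one. -/
theorem exists_codes_perm (n : ℕ) (Rs : List ℝ) : ∀ (o Rb X Q : List ℝ), Rb.Perm (X ++ Q) →
    Rb.length ≤ n → 0 < n →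
    ∃ cs : List (ℕ × ℕ), ∃ Rb' : List ℝ, cs.length = X.length ∧ (∀ c ∈ cs, c.1 ≤ n ∧ c.2 ≤ n) ∧
      Rb'.Perm Q ∧ Rb'.Sublist Rb ∧ arrange cs (o, Rb ++ Rs) = (o ++ X, Rb' ++ Rs) := by
  intro o Rb X Q hperm hn hpos
  induction X generalizing o Rb with
  | nil => exact ⟨[], Rb, rfl, by simp, hperm, List.Sublist.refl _, by simp [arrange_nil]⟩
  | cons x X ih =>
    obtain ⟨R1, R2, rfl⟩ := List.append_of_mem (hperm.mem_iff.2 (List.mem_cons_self : x ∈ x :: X ++ Q))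
    have hp : (R1 ++ R2).Perm (X ++ Q) :=
      (List.perm_cons x).1 (List.perm_middle.symm.trans hperm)
    obtain ⟨cs, Rb', h1, h2, h3, h4, h5⟩ := ih (o ++ [x]) (R1 ++ R2) hp (by simp at hn ⊢; omega)
    refine ⟨(1, R1.length) :: cs, Rb', by simp [h1], ?_, h3, h4.trans (by simp), ?_⟩
    · intro c hc
      rcases List.mem_cons.1 hc with rfl | hc
      · simp at hn ⊢; omega
      · exact h2 c hc
    · rw [arrange_cons]
      have := iterate_extract o R1 [x] (R2 ++ Rs)
      simp only [List.length_singleton] at this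
      simp only [List.append_assoc, List.cons_append, List.nil_append] at this h5 ⊢
      rw [this, h5]

/-- A block `X` with at most `G` heavy weights is mimicked by `G + 1` codes: one for every heavy weight,
void codes `(0, 0)` as padding, and a window for the light weights. The order inside the block is
not preserved, since only the weight at its end matters. -/
theorem Mimics.block {δ s : ℝ} {p X q : List ℝ} {st : List ℝ × List ℝ} {n G : ℕ}
    (h : Mimics δ s p (X ++ q) st) (hδ : 0 ≤ δ) (hn : (X ++ q).length ≤ n) (hpos : 0 < n)
    (hG : (X.filter (δ < ·)).length ≤ G) :
    ∃ cs : List (ℕ × ℕ), cs.length = G + 1 ∧ (∀ c ∈ cs, c.1 ≤ n ∧ c.2 ≤ n) ∧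
      Mimics δ (s + δ) (p ++ X) q (arrange cs st) := by
  have hlen2 := h.length_snd
  obtain ⟨o, L⟩ := st
  obtain ⟨Rb, Rs, d, h1, h2, h3, h4, h5⟩ := h.split
  have hsort := h.sorted
  have hnn := h.nonneg
  have hlen := h.length_eq
  simp only at h1 h5 hlen2 hsort hnn hlen
  subst h1
  rw [List.filter_append] at h2 h4
  have hRR : Rb.length + Rs.length ≤ n := by rw [List.length_append] at hlen2; omega
  obtain ⟨cs, Rb', c1, c2, c3, c4, c5⟩ := exists_codes_perm n Rs o Rb _ _ h2 (by omega) hpos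
  obtain ⟨a, d', w1, w2, w3⟩ := h4.window (δ := δ) (U := (X.filter (¬ δ < ·) : List ℝ))
    (fun x hx => ⟨hnn x (List.mem_append_right _ hx), h3 x hx⟩) hδ
    (by rw [← Multiset.coe_add]; exact Multiset.le_add_right _ _)
  set Xs := X.filter (¬ δ < ·) with hXs
  set Xb := X.filter (δ < ·) with hXb
  rw [Multiset.coe_card, Multiset.sum_coe] at w2
  rw [Multiset.coe_card] at w1 w3
  set V := (Rs.drop a).take Xs.length with hV
  have hVl : V.length = Xs.length := by simp [hV]; omega
  have c4l := c4.length_le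
  have hdec : arrange [(Xs.length, Rb'.length + a)] (o ++ Xb, Rb' ++ Rs)
      = (o ++ Xb ++ V, Rb' ++ (Rs.take a ++ Rs.drop (a + Xs.length))) := by
    have := iterate_extract (o ++ Xb) (Rb' ++ Rs.take a) V (Rs.drop (a + Xs.length))
    rw [List.length_append, List.length_take, min_eq_left (by omega), hVl] at this
    rw [arrange_cons, arrange_nil]
    have e : Rs = Rs.take a ++ V ++ Rs.drop (a + Xs.length) := by
      rw [hV, ← List.drop_drop, List.append_assoc, List.take_append_drop, List.take_append_drop]
    conv_lhs => rw [e]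
    simp only [List.append_assoc] at this ⊢
    exact this
  have hXlen : Xb.length + Xs.length = X.length := by
    have := (List.filter_append_perm (fun x => decide (δ < x)) X).length_eq
    rw [List.length_append] at this
    simp only [hXb, hXs, ← this, decide_not]
  have hXsum : Xb.sum + Xs.sum = X.sum := by
    have := (List.filter_append_perm (fun x => decide (δ < x)) X).sum_eq
    rw [List.sum_append] at this
    simp only [hXb, hXs, ← this, decide_not]
  have hsub : (Rs.take a ++ Rs.drop (a + Xs.length)).Sublist Rs := by
    conv_rhs => rw [← List.take_append_drop a Rs]
    refine List.Sublist.append (List.Sublist.refl _) ?_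
    rw [← List.drop_drop]; exact List.drop_sublist _ _
  refine ⟨cs ++ List.replicate (G - Xb.length) (0, 0) ++ [(Xs.length, Rb'.length + a)], ?_, ?_, ?_⟩
  · simp [c1]; omega
  · intro c hc
    simp only [List.mem_append, List.mem_singleton] at hc
    rcases hc with (hc | hc) | rfl
    · exact c2 c hc
    · rw [List.eq_of_mem_replicate hc]; simp
    · simp; constructor <;> omega
  · rw [arrange_append, arrange_append, c5, arrange_replicate_zero, hdec]
    refine ⟨?_, ?_, ?_, Rb', _, d', rfl, c3, ?_, ?_, ?_⟩
    · simp [hVl, hlen]; omega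
    · exact hsort.sublist (c4.append hsub)
    · intro x hx
      exact hnn x ((c4.append hsub).subset hx)
    · intro x hx
      exact h3 x (hsub.subset hx)
    · convert w3 using 1
      rw [← Multiset.coe_add, add_tsub_cancel_left]
    · simp only [List.sum_append]; linarith

theorem Mimics.blocks {δ : ℝ} {n G : ℕ} (hδ : 0 ≤ δ) (hpos : 0 < n) (q : List ℝ) :
    ∀ (Bs : List (List ℝ)) (s : ℝ) (p : List ℝ) (st : List ℝ × List ℝ),
    Mimics δ s p (Bs.flatten ++ q) st → (Bs.flatten ++ q).length ≤ n →
    (∀ X ∈ Bs, (X.filter (δ < ·)).length ≤ G) →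
    ∃ cs : List (ℕ × ℕ), cs.length = Bs.length * (G + 1) ∧ (∀ c ∈ cs, c.1 ≤ n ∧ c.2 ≤ n) ∧
      Mimics δ (s + Bs.length * δ) (p ++ Bs.flatten) q (arrange cs st) ∧
      ∀ B₁ B₂, Bs = B₁ ++ B₂ →
        ((arrange cs st).1.take (p ++ B₁.flatten).length).sum ≤ (p ++ B₁.flatten).sum ∧
        (p ++ B₁.flatten).sum - (s + Bs.length * δ) ≤
          ((arrange cs st).1.take (p ++ B₁.flatten).length).sum := by
  have key : ∀ (s : ℝ) (p q' : List ℝ) (st : List ℝ × List ℝ) (cs : List (ℕ × ℕ)) (k : ℕ),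
      Mimics δ s p q' st →
      ((arrange cs st).1.take p.length).sum ≤ p.sum ∧
        p.sum - (s + k * δ) ≤ ((arrange cs st).1.take p.length).sum := by
    intro s p q' st cs k hm
    have e : (arrange cs st).1.take p.length = st.1 := by
      rw [← hm.length_eq]; exact (List.prefix_iff_eq_take.1 (prefix_arrange cs st)).symm
    rw [e]
    have := hm.sum_le
    have : 0 ≤ k * δ := by positivity
    constructor <;> linarith
  intro Bs
  induction Bs with
  | nil =>
    intro s p st h hn hG
    refine ⟨[], by simp, by simp, by simpa [arrange_nil] using h, ?_⟩
    intro B₁ B₂ hB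
    obtain ⟨rfl, rfl⟩ := List.append_eq_nil_iff.1 hB.symm
    simpa using key s p _ st [] 0 h
  | cons X Bs ih =>
    intro s p st h hn hG
    rw [List.flatten_cons, List.append_assoc] at h hn
    obtain ⟨cs, c1, c2, c3⟩ := h.block hδ hn hpos (hG X List.mem_cons_self)
    obtain ⟨cs', d1, d2, d3, d4⟩ := ih (s + δ) (p ++ X) (arrange cs st) c3
      (by simp at hn ⊢; omega) (fun Y hY => hG Y (List.mem_cons_of_mem _ hY))
    have es : s + δ + Bs.length * δ = s + (X :: Bs).length * δ := by
      push_cast [List.length_cons]; ring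
    refine ⟨cs ++ cs', by simp [c1, d1]; ring, ?_, ?_, ?_⟩
    · intro c hc
      rcases List.mem_append.1 hc with hc | hc
      exacts [c2 c hc, d2 c hc]
    · rw [arrange_append, ← es]
      simpa using d3
    · intro B₁ B₂ hB
      cases B₁ with
      | nil => simpa using key s p _ st (cs ++ cs') (Bs.length + 1) h
      | cons Y B₁ =>
        rw [List.cons_append, List.cons.injEq] at hB
        obtain ⟨rfl, hB⟩ := hB
        have := d4 B₁ B₂ hB
        rw [es] at this
        simpa [arrange_append] using this

/-! ### Cutting a ranking into blocks -/

theorem exists_light_prefix {κ : ℝ} (hκ : 0 ≤ κ) (A : List ℝ) :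
    ∃ X R, A = X ++ R ∧ X.sum ≤ κ ∧ ∀ y R', R = y :: R' → κ < X.sum + y := by
  induction A generalizing κ with
  | nil => exact ⟨[], [], rfl, by simpa, by simp⟩
  | cons x A ih =>
    by_cases hx : x ≤ κ
    · obtain ⟨X, R, rfl, h1, h2⟩ := ih (sub_nonneg.2 hx)
      refine ⟨x :: X, R, rfl, by simp; linarith, fun y R' h => ?_⟩
      have := h2 y R' h
      simp; linarith
    · refine ⟨[], x :: A, rfl, by simpa, fun y R' h => ?_⟩
      obtain ⟨rfl, rfl⟩ := List.cons.inj h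
      simpa using hx

/-- A maximal prefix of weight at most `κ` together with the next element weighs more than `κ`; repeating
this `T` times gives the blocks, padded with empty ones if the list is exhausted. -/
theorem exists_blocks {κ : ℝ} (hκ : 0 ≤ κ) (T : ℕ) (A : List ℝ) :
    ∃ (Bs : List (List ℝ)) (q : List ℝ), A = Bs.flatten ++ q ∧ Bs.length = 2 * T ∧
      (∀ X ∈ Bs, X.sum ≤ κ ∨ X.length = 1) ∧ (q = [] ∨ T * κ ≤ Bs.flatten.sum) := by
  induction T generalizing A with
  | zero => exact ⟨[], A, by simp, by simp, by simp, Or.inr (by simp)⟩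
  | succ T ih =>
    obtain ⟨X, R, rfl, h1, h2⟩ := exists_light_prefix hκ A
    cases R with
    | nil =>
      refine ⟨X :: List.replicate (2 * T + 1) [], [], by simp, by simp; ring, ?_, Or.inl rfl⟩
      intro Y hY
      rcases List.mem_cons.1 hY with rfl | hY
      · exact Or.inl h1
      · rw [List.eq_of_mem_replicate hY]; left; simpa
    | cons y R =>
      obtain ⟨Bs, q, rfl, b1, b2, b3⟩ := ih R
      refine ⟨X :: [y] :: Bs, q, by simp, by simp [b1]; ring, ?_, ?_⟩
      · intro Y hY
        simp only [List.mem_cons] at hY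
        rcases hY with rfl | rfl | hY
        · exact Or.inl h1
        · exact Or.inr rfl
        · exact b2 Y hY
      · refine b3.imp id fun h => ?_
        have := h2 y _ rfl
        simp only [List.flatten_cons, List.sum_append, List.sum_singleton]
        push_cast; linarith

theorem exists_mem_block {Bs : List (List ℝ)} {p : ℕ} (hp : p < Bs.flatten.length) :
    ∃ B₁ X B₂, Bs = B₁ ++ X :: B₂ ∧ B₁.flatten.length ≤ p ∧
      p < B₁.flatten.length + X.length := by
  induction Bs generalizing p with
  | nil => simp at hp
  | cons Y Bs ih =>
    rcases lt_or_ge p Y.length with h | h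
    · exact ⟨[], Y, Bs, rfl, by simp, by simpa⟩
    · obtain ⟨B₁, X, B₂, rfl, h1, h2⟩ := ih (p := p - Y.length) (by rw [List.flatten_cons, List.length_append] at hp; omega)
      exact ⟨Y :: B₁, X, B₂, rfl, by rw [List.flatten_cons, List.length_append]; omega,
        by rw [List.flatten_cons, List.length_append]; omega⟩

theorem sum_take_mono {l : List ℝ} (h : ∀ x ∈ l, 0 ≤ x) {i j : ℕ} (hij : i ≤ j) :
    (l.take i).sum ≤ (l.take j).sum := by
  obtain ⟨k, rfl⟩ := Nat.exists_eq_add_of_le hij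
  rw [List.take_add, List.sum_append]
  have : 0 ≤ ((l.drop i).take k).sum :=
    List.sum_nonneg fun x hx => h x (List.mem_of_mem_drop (List.mem_of_mem_take hx))
  linarith

theorem sum_filter_length_le {l : List ℝ} (h : ∀ x ∈ l, 0 ≤ x) (δ : ℝ) :
    (l.filter (δ < ·)).length * δ ≤ l.sum := by
  induction l with
  | nil => simp
  | cons x l ih =>
    have ih := ih fun y hy => h y (List.mem_cons_of_mem _ hy)
    have hx := h x List.mem_cons_self
    by_cases hd : δ < x
    · simp [hd] at ih ⊢; linarith
    · simp [hd] at ih ⊢; linarith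

/-! ### Comparing the choices of a customer -/

/-- A customer with reservation prices `r`, facing products with weights `l` in this order, stops at `p`. -/
structure StopsAt (n : ℕ) (r : Fin n → ℝ) (l : List ℝ) (p : Fin n) : Prop where
  lt : ∀ q < p, (l.take (q + 1)).sum < r q
  le : r p ≤ (l.take (p + 1)).sum ∨ (p : ℕ) + 1 = n

/-- A customer who gets past the first `c` products in `A` gets past them in `B` if they are no heavier
in `B`: the last of these `c` positions has the lowest reservation price. -/
theorem StopsAt.le_of_le {n : ℕ} {r : Fin n → ℝ} (hr : Antitone r) {A B : List ℝ} {p q : Fin n}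
    (hA : StopsAt n r A p) (hB : StopsAt n r B q) (hB0 : ∀ x ∈ B, 0 ≤ x) {c : ℕ}
    (hc : c ≤ p) (hle : (B.take c).sum ≤ (A.take c).sum) : c ≤ q := by
  by_contra hlt
  push Not at hlt
  have hp := p.2
  have hq := q.2
  have h1 : r q ≤ (B.take (q + 1)).sum := by
    rcases hB.le with h | h
    · exact h
    · omega
  have h2 := sum_take_mono hB0 (show (q : ℕ) + 1 ≤ c by omega)
  have h3 := hA.lt ⟨c - 1, by omega⟩ (Fin.lt_def.2 (by simp; omega))
  have h4 := hr (show q ≤ ⟨c - 1, by omega⟩ from Fin.le_def.2 (by simp; omega))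
  simp only [show c - 1 + 1 = c by omega] at h3
  linarith

theorem share_mono {x y : ℝ} (hx : 0 ≤ x) (hxy : x ≤ y) : x / (1 + x) ≤ y / (1 + y) := by
  rw [div_le_div_iff₀ (by linarith) (by linarith)]; nlinarith

theorem share_sub_le {x y z : ℝ} (hy : 0 ≤ y) (hz : 0 ≤ z) (hx : 0 ≤ x) (h : x ≤ y + z) :
    x / (1 + x) - z ≤ y / (1 + y) := by
  rcases le_total x y with hxy | hxy
  · linarith [share_mono hx hxy]
  · have : x / (1 + x) - y / (1 + y) = (x - y) / ((1 + x) * (1 + y)) := by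
      field_simp; ring
    have h2 : (x - y) / ((1 + x) * (1 + y)) ≤ x - y :=
      div_le_self (by linarith) (by nlinarith)
    linarith

theorem share_mul_le {x c : ℝ} (hx : 0 ≤ x) (hc : 0 ≤ c) (hc1 : c ≤ 1) :
    c * (x / (1 + x)) ≤ c * x / (1 + c * x) := by
  rw [mul_div_assoc', div_le_div_iff₀ (by linarith) (by nlinarith)]
  nlinarith [mul_nonneg hc hx, mul_nonneg (mul_nonneg hc hx) (mul_nonneg (sub_nonneg.2 hc1) hx)]

/-- The share of a customer in a ranking `B` that is slightly behind `A` at all block ends and in the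
tail. -/
theorem customer_le {n : ℕ} {r : Fin n → ℝ} (hr : Antitone r) {A B : List ℝ} {p p' : Fin n}
    (hA : StopsAt n r A p) (hB : StopsAt n r B p') (hB0 : ∀ x ∈ B, 0 ≤ x)
    (hA0 : ∀ x ∈ A, 0 ≤ x) {e u M : ℝ} (he : 0 < e) (he' : e ≤ 1 / 2) (hu : u = min M 1)
    (hu0 : 0 < u) (hM : ∀ x ∈ A, x ≤ M) {Bs : List (List ℝ)} {q : List ℝ}
    (hsplit : A = Bs.flatten ++ q) (hn : A.length = n)
    (hblock : ∀ X ∈ Bs, X.sum ≤ e * u ∨ X.length = 1)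
    (hclose : ∀ B₁ B₂, Bs = B₁ ++ B₂ →
      (B.take B₁.flatten.length).sum ≤ B₁.flatten.sum ∧
      B₁.flatten.sum - e * u ≤ (B.take B₁.flatten.length).sum)
    (htail : ∀ t ≤ q.length,
      (A.take (Bs.flatten.length + t)).sum ≤ (B.take (Bs.flatten.length + t)).sum + e * u)
    (hcap : q = [] ∨ u / e ≤ Bs.flatten.sum) :
    (1 - 2 * e) * ((A.take (p + 1)).sum / (1 + (A.take (p + 1)).sum)) - 2 * (e * u) ≤
      (B.take (p' + 1)).sum / (1 + (B.take (p' + 1)).sum) := by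
  have hnn : ∀ (l : List ℝ) (k : ℕ), (∀ x ∈ l, 0 ≤ x) → 0 ≤ (l.take k).sum := fun l k h =>
    List.sum_nonneg fun x hx => h x (List.mem_of_mem_take hx)
  have hWA := hnn A (p + 1) hA0
  have hWB := hnn B (p' + 1) hB0
  have hfA : 0 ≤ (A.take (p + 1)).sum / (1 + (A.take (p + 1)).sum) := by positivity
  have hfA1 : (A.take (p + 1)).sum / (1 + (A.take (p + 1)).sum) ≤ 1 := by
    rw [div_le_one (by linarith)]; linarith
  have heu : 0 < e * u := by positivity
  have add : (A.take (p + 1)).sum ≤ (B.take (p' + 1)).sum + 2 * (e * u) →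
      (1 - 2 * e) * ((A.take (p + 1)).sum / (1 + (A.take (p + 1)).sum)) - 2 * (e * u) ≤
      (B.take (p' + 1)).sum / (1 + (B.take (p' + 1)).sum) := by
    intro h
    have := share_sub_le hWB (by positivity) hWA h
    nlinarith
  rcases lt_or_ge (p : ℕ) Bs.flatten.length with hp | hp
  · -- The customer stops in a block in `A`.
    obtain ⟨B₁, X, B₂, rfl, h1, h2⟩ := exists_mem_block hp
    have eA : A = B₁.flatten ++ (X ++ (B₂.flatten ++ q)) := by rw [hsplit]; simp
    have tA : (A.take B₁.flatten.length).sum = B₁.flatten.sum := by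
      rw [eA, List.take_left]
    have tX : (A.take (B₁.flatten.length + X.length)).sum = B₁.flatten.sum + X.sum := by
      rw [eA, List.take_length_add_append, List.take_left, List.sum_append]
    obtain ⟨c1, c2⟩ := hclose B₁ (X :: B₂) rfl
    have hp' := hA.le_of_le hr hB hB0 h1 (by rw [tA]; exact c1)
    have m1 := sum_take_mono hA0 (show (p : ℕ) + 1 ≤ B₁.flatten.length + X.length by omega)
    rw [tX] at m1
    apply add
    rcases hblock X (by simp) with hX | hX
    · have m2 := sum_take_mono hB0 (show B₁.flatten.length ≤ p' + 1 by omega)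
      linarith
    · obtain ⟨c3, c4⟩ := hclose (B₁ ++ [X]) B₂ (by simp)
      have m2 := sum_take_mono hB0 (show B₁.flatten.length + X.length ≤ p' + 1 by omega)
      rw [List.flatten_append, List.flatten_singleton, List.length_append, List.sum_append] at c4
      linarith
  · -- The customer stops in the tail in `A`.
    have hq : q ≠ [] := by
      rintro rfl
      have := p.2
      rw [hsplit, List.append_nil] at hn; omega
    have hcap := hcap.resolve_left hq
    obtain ⟨c1, c2⟩ := hclose Bs [] (by simp)
    have hp' := hA.le_of_le hr hB hB0 hp (by rw [hsplit, List.take_left]; exact c1)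
    have m2 := sum_take_mono hB0 (show Bs.flatten.length ≤ p' + 1 by omega)
    have hBl : u / e - e * u ≤ (B.take (p' + 1)).sum := by linarith
    rcases le_total M 1 with hM1 | hM1
    · rw [min_eq_left hM1] at hu
      subst hu
      rcases le_or_gt (p : ℕ) p' with hpp | hpp
      · apply add
        have h := htail (p + 1 - Bs.flatten.length) (by
          have := p.2
          rw [hsplit, List.length_append] at hn; omega)
        rw [show Bs.flatten.length + (p + 1 - Bs.flatten.length) = (p : ℕ) + 1 by omega] at h
        have m3 := sum_take_mono hB0 (show (p : ℕ) + 1 ≤ p' + 1 by omega)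
        linarith
      · -- The price is reached in `B` but was not reached in `A` one position before `p`, so that
        -- `A` is ahead by the weight of one product at most.
        have hpn := p.2
        have h1 : r p' ≤ (B.take (p' + 1)).sum := by
          rcases hB.le with h | h
          · exact h
          · omega
        have h3 := hA.lt ⟨p - 1, by omega⟩ (Fin.lt_def.2 (by simp; omega))
        have h4 := hr (show p' ≤ ⟨p - 1, by omega⟩ from Fin.le_def.2 (by simp; omega))
        simp only [show (p : ℕ) - 1 + 1 = p by omega] at h3
        have h5 : (A.take (p + 1)).sum = (A.take p).sum + A[(p : ℕ)] := by
          rw [List.sum_take_succ]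
        have h6 := hM _ (List.getElem_mem (show (p : ℕ) < A.length by omega))
        have h7 : u ≤ 2 * e * (B.take (p' + 1)).sum := by
          have : 2 * e * (u / e - e * u) ≤ 2 * e * (B.take (p' + 1)).sum := by gcongr
          have e2 : 2 * e * (u / e - e * u) = 2 * u - 2 * (e * e) * u := by field_simp
          nlinarith
        have h8 : (1 - 2 * e) * (A.take (p + 1)).sum ≤ (B.take (p' + 1)).sum := by nlinarith
        have h9 := share_mul_le hWA (c := 1 - 2 * e) (by linarith) (by linarith)
        have h10 := share_mono (mul_nonneg (by linarith) hWA) h8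
        linarith
    · rw [min_eq_right hM1] at hu
      subst hu
      have h1 : 1 - e ≤ (B.take (p' + 1)).sum / (1 + (B.take (p' + 1)).sum) := by
        rw [le_div_iff₀ (by linarith)]
        have : e * (1 / e - e * 1) ≤ e * (B.take (p' + 1)).sum := by gcongr
        have e2 : e * (1 / e - e * 1) = 1 - e * e := by field_simp
        nlinarith
      nlinarith

/-! ### A near-optimal arrangement -/

/-- The number of blocks of bounded weight, and of the single products between them. -/
noncomputable def pairCount (e : ℝ) : ℕ := ⌈1 / e ^ 2⌉₊

/-- The number of codes: `2 * pairCount e` blocks with `2 * pairCount e` heavy products each at most, and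
one further code per block for the light products. -/
noncomputable def codeCount (e : ℝ) : ℕ := 2 * pairCount e * (2 * pairCount e + 1)

namespace Market

/-- The weights of the products in the order of their positions. -/
def weightList (I : Market) (A : I.Assignment) : List ℝ := List.ofFn fun p => I.w (A p)

theorem length_weightList (I : Market) (A : I.Assignment) : (I.weightList A).length = I.n := by
  simp [weightList]

theorem weightList_perm (I : Market) (A B : I.Assignment) :
    (I.weightList A).Perm (I.weightList B) :=
  (Equiv.Perm.ofFn_comp_perm A I.w).trans (Equiv.Perm.ofFn_comp_perm B I.w).symm

theorem weightList_nonneg (I : Market) (A : I.Assignment) : ∀ x ∈ I.weightList A, 0 ≤ x := by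
  intro x hx
  obtain ⟨p, rfl⟩ := (List.mem_ofFn' _ _).1 hx
  exact I.w_nonneg _

theorem weight_placed (I : Market) (A : I.Assignment) (p : Fin I.n) :
    I.weight (I.placed A p) = ((I.weightList A).take (p + 1)).sum := by
  rw [weightList, List.sum_take_ofFn, weight, placed, Finset.sum_image A.injective.injOn]
  refine Finset.sum_congr ?_ fun _ _ => rfl
  ext q
  rw [Finset.mem_Iic, Finset.mem_filter, Fin.le_def, Nat.lt_succ_iff]
  exact ⟨fun h => ⟨Finset.mem_univ _, h⟩, fun h => h.2⟩

theorem mem_stopCandidates (I : Market) (A : I.Assignment) (k : Fin I.K) (p : Fin I.n) :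
    p ∈ I.stopCandidates A k ↔ I.r k p ≤ ((I.weightList A).take (p + 1)).sum := by
  rw [stopCandidates, Finset.mem_filter, weight_placed]
  exact ⟨fun h => h.2, fun h => ⟨Finset.mem_univ _, h⟩⟩

theorem stopsAt_stopPos (I : Market) (A : I.Assignment) (k : Fin I.K) :
    StopsAt I.n (I.r k) (I.weightList A) (I.stopPos A k) := by
  have hn := I.n_pos
  unfold stopPos
  split_ifs with h
  · refine ⟨fun q hq => ?_, Or.inl ((I.mem_stopCandidates A k _).1 (Finset.min'_mem _ h))⟩
    by_contra hlt
    exact absurd (Finset.min'_le _ _ ((I.mem_stopCandidates A k q).2 (not_lt.1 hlt)))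
      (not_le.2 hq)
  · refine ⟨fun q _ => ?_, Or.inr (by simp; omega)⟩
    by_contra hlt
    exact h ⟨q, (I.mem_stopCandidates A k q).2 (not_lt.1 hlt)⟩

theorem segmentShare_eq (I : Market) (A : I.Assignment) (k : Fin I.K) :
    I.segmentShare A k = ((I.weightList A).take (I.stopPos A k + 1)).sum /
      (1 + ((I.weightList A).take (I.stopPos A k + 1)).sum) := by
  rw [segmentShare, considered, weight_placed]

theorem share_nonneg (I : Market) (A : I.Assignment) : 0 ≤ I.share A := by
  refine Finset.sum_nonneg fun k _ => mul_nonneg (I.θ_nonneg k) ?_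
  have : 0 ≤ I.weight (I.considered A k) := Finset.sum_nonneg fun i _ => I.w_nonneg i
  unfold segmentShare
  positivity

theorem exists_share_eq_opt (I : Market) : ∃ A, I.share A = I.opt := by
  obtain ⟨A, -, h⟩ := Finset.exists_mem_eq_sup' (Finset.univ_nonempty (α := I.Assignment)) I.share
  exact ⟨A, h.symm⟩

theorem share_le_opt (I : Market) (A : I.Assignment) : I.share A ≤ I.opt :=
  Finset.le_sup' I.share (Finset.mem_univ A)

/-- Some arrangement of the sorted products is nearly optimal. -/
theorem exists_codes (I : Market) {e : ℝ} (he : 0 < e) (he' : e ≤ 1 / 6) (σ : I.Assignment)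
    (hσ : (I.weightList σ).Pairwise (· ≥ ·)) :
    ∃ cs : List (ℕ × ℕ), cs.length = codeCount e ∧ (∀ c ∈ cs, c.1 ≤ I.n ∧ c.2 ≤ I.n) ∧
      ∀ B : I.Assignment, I.weightList B = (arrange cs ([], I.weightList σ)).1 ++
        (arrange cs ([], I.weightList σ)).2 → (1 - 6 * e) * I.opt ≤ I.share B := by
  have hn := I.n_pos
  set M := I.w (σ ⟨0, hn⟩) with hM
  have hcons : ∃ l, I.weightList σ = M :: l := by
    have h0 : (I.weightList σ)[0]'(by rw [length_weightList]; exact hn) = M := by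
      simp [weightList, hM]
    refine ⟨(I.weightList σ).tail, ?_⟩
    rw [← h0, List.getElem_zero_eq_head, List.cons_head_tail]
  obtain ⟨l, hl⟩ := hcons
  have hmax : ∀ (A : I.Assignment), ∀ x ∈ I.weightList A, x ≤ M := by
    intro A x hx
    have hx := (I.weightList_perm A σ).mem_iff.1 hx
    rw [hl] at hx hσ
    rcases List.mem_cons.1 hx with rfl | hx
    · exact le_rfl
    · exact List.rel_of_pairwise_cons hσ hx
  obtain ⟨A, hA⟩ := I.exists_share_eq_opt
  have hM0 : 0 ≤ M := I.w_nonneg _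
  -- If all weights vanish, the threshold between light and heavy products would be `0`.
  rcases hM0.eq_or_lt with hM0 | hM0
  · refine ⟨List.replicate (codeCount e) (0, 0), by simp, ?_, ?_⟩
    · intro c hc
      rw [List.eq_of_mem_replicate hc]; simp
    · intro B _
      have : I.opt = 0 := by
        rw [← hA]
        refine Finset.sum_eq_zero fun k _ => ?_
        have hz : ∀ x ∈ I.weightList A, x = 0 := fun x hx =>
          le_antisymm (hM0 ▸ hmax A x hx) (I.weightList_nonneg A x hx)
        rw [segmentShare_eq, List.sum_eq_zero fun x hx => hz x (List.mem_of_mem_take hx)]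
        simp
      rw [this, mul_zero]
      exact I.share_nonneg B
  set u := min M 1 with hu
  have hu0 : 0 < u := lt_min hM0 one_pos
  have hκ : 0 < e * u := mul_pos he hu0
  set T := pairCount e with hT
  have hT1 : 1 / e ^ 2 ≤ T := Nat.le_ceil _
  have hTpos : 0 < (T : ℝ) := lt_of_lt_of_le (by positivity) hT1
  have hTpos' : 0 < T := by exact_mod_cast hTpos
  obtain ⟨Bs, q, hsplit, hlen, hblock, hcap⟩ := exists_blocks hκ.le T (I.weightList A)
  set δ := e * u / (2 * T) with hδ
  have hδ0 : 0 < δ := by positivity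
  have hTδ : ((2 * T : ℕ) : ℝ) * δ = e * u := by
    rw [hδ]; push_cast; field_simp
  have hAnn := I.weightList_nonneg A
  have hinit := Mimics.init (δ := δ) hσ (I.weightList_perm σ A) (I.weightList_nonneg σ)
  have hAlen := I.length_weightList A
  rw [hsplit] at hinit
  obtain ⟨cs, c1, c2, c3, c4⟩ := Mimics.blocks (n := I.n) (G := 2 * T) hδ0.le hn q Bs 0 [] _ hinit
    (by rw [← hsplit, hAlen]) (by
      intro X hX
      rcases hblock X hX with h | h
      · have h1 := sum_filter_length_le (l := X) (fun x hx => hAnn x (by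
          rw [hsplit]; exact List.mem_append_left _ (List.mem_flatten_of_mem hX hx))) δ
        have h2 := h1.trans (h.trans hTδ.ge)
        have h3 := le_of_mul_le_mul_right h2 hδ0
        exact_mod_cast h3
      · exact (List.length_filter_le _ _).trans (by omega))
  rw [hlen, hTδ, zero_add, List.nil_append] at c3
  simp only [hlen, hTδ, zero_add, List.nil_append] at c4
  refine ⟨cs, by rw [c1, hlen, codeCount], c2, ?_⟩
  intro B hB
  set st := arrange cs ([], I.weightList σ) with hst
  have hst1 : st.1.length = Bs.flatten.length := c3.length_eq
  have hcust : ∀ k, (1 - 2 * e) * I.segmentShare A k - 2 * (e * u) ≤ I.segmentShare B k := by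
    intro k
    rw [segmentShare_eq, segmentShare_eq]
    refine customer_le (I.r_antitone k) (I.stopsAt_stopPos A k) (I.stopsAt_stopPos B k)
      (I.weightList_nonneg B) hAnn he (by linarith) hu hu0 (hmax A) hsplit hAlen hblock ?_ ?_ ?_
    · intro B₁ B₂ h
      have hle : B₁.flatten.length ≤ st.1.length := by
        rw [hst1, h]; simp
      rw [hB, List.take_append_of_le_length hle]
      exact c4 B₁ B₂ h
    · intro t ht
      have := c3.sum_take_le t ht
      rw [hB, ← hst1, List.take_length_add_append, hst1, hsplit, List.take_length_add_append,
        List.sum_append, List.sum_append]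
      linarith
    · refine hcap.imp id fun h => le_trans ?_ h
      calc u / e = 1 / e ^ 2 * (e * u) := by field_simp
        _ ≤ T * (e * u) := by gcongr
  have hsum : (1 - 2 * e) * I.opt - 2 * (e * u) ≤ I.share B := by
    have : (1 - 2 * e) * I.opt - 2 * (e * u) =
        ∑ k, I.θ k * ((1 - 2 * e) * I.segmentShare A k - 2 * (e * u)) := by
      simp only [mul_sub, Finset.sum_sub_distrib, ← Finset.sum_mul, I.θ_sum, one_mul, ← hA, share,
        Finset.mul_sum]
      congr 1
      refine Finset.sum_congr rfl fun k _ => by ring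
    rw [this]
    exact Finset.sum_le_sum fun k _ => mul_le_mul_of_nonneg_left (hcust k) (I.θ_nonneg k)
  have hopt : u / 2 ≤ I.opt := by
    refine le_trans ?_ (I.share_le_opt σ)
    have : u / 2 = ∑ k, I.θ k * (u / 2) := by rw [← Finset.sum_mul, I.θ_sum, one_mul]
    rw [this]
    refine Finset.sum_le_sum fun k _ => mul_le_mul_of_nonneg_left ?_ (I.θ_nonneg k)
    rw [segmentShare_eq]
    have h1 := sum_take_mono (I.weightList_nonneg σ)
      (show 1 ≤ (I.stopPos σ k : ℕ) + 1 by omega)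
    have h2 : ((I.weightList σ).take 1).sum = M := by rw [hl]; simp
    have h3 : u ≤ ((I.weightList σ).take (I.stopPos σ k + 1)).sum := by
      rw [h2] at h1; exact (min_le_left _ _).trans h1
    refine le_trans ?_ (share_mono hu0.le h3)
    have : u ≤ 1 := min_le_right _ _
    gcongr
    linarith
  nlinarith

end Market

/-! ### A calculus for the running time of programs -/

namespace Mem

@[simp] theorem real_setNat (m : Mem) (a i x : ℕ) : (m.setNat a i x).real = m.real := rfl

@[simp] theorem nat_setReal (m : Mem) (a i : ℕ) (x : ℝ) : (m.setReal a i x).nat = m.nat := rfl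

@[simp] theorem nat_setNat_self (m : Mem) (a i x : ℕ) :
    (m.setNat a i x).nat a = Function.update (m.nat a) i x := by
  funext j; simp [Mem.setNat, Function.update_apply]

@[simp] theorem real_setReal_self (m : Mem) (a i : ℕ) (x : ℝ) :
    (m.setReal a i x).real a = Function.update (m.real a) i x := by
  funext j; simp [Mem.setReal, Function.update_apply]

@[simp] theorem nat_setNat_of_ne (m : Mem) {a b : ℕ} (i x : ℕ) (h : b ≠ a) :
    (m.setNat a i x).nat b = m.nat b := by
  funext j; simp [Mem.setNat, h]

@[simp] theorem real_setReal_of_ne (m : Mem) {a b : ℕ} (i : ℕ) (x : ℝ) (h : b ≠ a) :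
    (m.setReal a i x).real b = m.real b := by
  funext j; simp [Mem.setReal, h]

end Mem

namespace Prog

/-- Total correctness with a time bound: started in `m`, the program `P` halts after at most `T`
operations in a memory satisfying `Q`. -/
def Spec (P : Prog) (T : ℕ) (m : Mem) (Q : Mem → Prop) : Prop :=
  ∃ m' t, P.Run m m' t ∧ t ≤ T ∧ Q m'

theorem Spec.mono {P : Prog} {T T' : ℕ} {m : Mem} {Q Q' : Mem → Prop} (h : P.Spec T m Q)
    (hT : T ≤ T') (hQ : ∀ m', Q m' → Q' m') : P.Spec T' m Q' := by
  obtain ⟨m', t, h1, h2, h3⟩ := h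
  exact ⟨m', t, h1, h2.trans hT, hQ m' h3⟩

theorem Spec.skip {m : Mem} {Q : Mem → Prop} (h : Q m) : Prog.skip.Spec 1 m Q :=
  ⟨m, 1, .skip m, le_rfl, h⟩

theorem Spec.setNat {m : Mem} {a : ℕ} {i e : NatExpr} {Q : Mem → Prop}
    (h : Q (m.setNat a (i.eval m) (e.eval m))) :
    (Prog.setNat a i e).Spec (i.cost + e.cost + 1) m Q :=
  ⟨_, _, .setNat m a i e, le_rfl, h⟩

theorem Spec.setReal {m : Mem} {a : ℕ} {i : NatExpr} {e : RealExpr} {Q : Mem → Prop}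
    (h : Q (m.setReal a (i.eval m) (e.eval m))) :
    (Prog.setReal a i e).Spec (i.cost + e.cost + 1) m Q :=
  ⟨_, _, .setReal m a i e, le_rfl, h⟩

theorem Spec.seq {P P' : Prog} {T T' : ℕ} {m : Mem} {Q Q' : Mem → Prop} (h : P.Spec T m Q)
    (h' : ∀ m', Q m' → P'.Spec T' m' Q') : (Prog.seq P P').Spec (T + T') m Q' := by
  obtain ⟨m', t, h1, h2, h3⟩ := h
  obtain ⟨m'', t', h1', h2', h3'⟩ := h' m' h3
  exact ⟨m'', _, .seq h1 h1', add_le_add h2 h2', h3'⟩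

theorem Spec.ite {b : BoolExpr} {P P' : Prog} {T : ℕ} {m : Mem} {Q : Mem → Prop}
    (h : b.holds m → P.Spec T m Q) (h' : ¬ b.holds m → P'.Spec T m Q) :
    (Prog.ite b P P').Spec (b.cost + 1 + T) m Q := by
  by_cases hb : b.holds m
  · obtain ⟨m', t, h1, h2, h3⟩ := h hb
    exact ⟨m', _, .ite_true hb h1, by omega, h3⟩
  · obtain ⟨m', t, h1, h2, h3⟩ := h' hb
    exact ⟨m', _, .ite_false hb h1, by omega, h3⟩

/-- The arrays of natural numbers that a program may modify. -/
def natWrites : Prog → List ℕ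
  | .skip => []
  | .setNat a _ _ => [a]
  | .setReal _ _ _ => []
  | .seq P Q => P.natWrites ++ Q.natWrites
  | .ite _ P Q => P.natWrites ++ Q.natWrites
  | .loop _ P => P.natWrites

/-- The arrays of real numbers that a program may modify. -/
def realWrites : Prog → List ℕ
  | .skip => []
  | .setNat _ _ _ => []
  | .setReal a _ _ => [a]
  | .seq P Q => P.realWrites ++ Q.realWrites
  | .ite _ P Q => P.realWrites ++ Q.realWrites
  | .loop _ P => P.realWrites

theorem Run.frame {P : Prog} {m m' : Mem} {t : ℕ} (h : P.Run m m' t) :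
    (∀ a ∉ P.natWrites, m'.nat a = m.nat a) ∧ (∀ a ∉ P.realWrites, m'.real a = m.real a) := by
  induction h with
  | skip m => simp
  | setNat m a i e => simp +contextual [natWrites]
  | setReal m a i e => simp +contextual [realWrites]
  | seq _ _ ih ih' =>
    simp only [natWrites, realWrites, List.mem_append, not_or]
    exact ⟨fun a ha => (ih'.1 a ha.2).trans (ih.1 a ha.1),
      fun a ha => (ih'.2 a ha.2).trans (ih.2 a ha.1)⟩
  | ite_true _ _ ih =>
    simp only [natWrites, realWrites, List.mem_append, not_or]
    exact ⟨fun a ha => ih.1 a ha.1, fun a ha => ih.2 a ha.1⟩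
  | ite_false _ _ ih =>
    simp only [natWrites, realWrites, List.mem_append, not_or]
    exact ⟨fun a ha => ih.1 a ha.2, fun a ha => ih.2 a ha.2⟩
  | loop_true _ _ _ ih ih' =>
    exact ⟨fun a ha => (ih'.1 a ha).trans (ih.1 a ha), fun a ha => (ih'.2 a ha).trans (ih.2 a ha)⟩
  | loop_false _ => simp

/-- The frame rule: arrays that the program does not mention on a left-hand side are unchanged. -/
theorem Spec.frame {P : Prog} {T : ℕ} {m : Mem} {Q : Mem → Prop} (h : P.Spec T m Q) :
    P.Spec T m fun m' => Q m' ∧ (∀ a ∉ P.natWrites, m'.nat a = m.nat a) ∧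
      (∀ a ∉ P.realWrites, m'.real a = m.real a) := by
  obtain ⟨m', t, h1, h2, h3⟩ := h
  exact ⟨m', t, h1, h2, h3, h1.frame⟩

/-- The loop in which cell `i` of the array `a` of natural numbers counts from `0` up to the value of
`e`, exclusively. The counter equals this value when the loop is left. -/
def forTo (a i : ℕ) (e : NatExpr) (P : Prog) : Prog :=
  .seq (.setNat a (.lit i) (.lit 0))
    (.loop (.not (.natLe e (.get a (.lit i))))
      (.seq P (.setNat a (.lit i) (.add (.get a (.lit i)) (.lit 1)))))

/-- `Inv k` is an invariant that holds when the counter has just been set to `k`. -/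
theorem Spec.forTo {a i : ℕ} {e : NatExpr} {P : Prog} {b T : ℕ} {m : Mem} (Inv : ℕ → Mem → Prop)
    (h0 : Inv 0 (m.setNat a i 0)) (hb : ∀ k m', m'.nat a i = k → Inv k m' → e.eval m' = b)
    (hstep : ∀ k < b, ∀ m', m'.nat a i = k → Inv k m' →
      P.Spec T m' fun m'' => m''.nat a i = k ∧ Inv (k + 1) (m''.setNat a i (k + 1))) :
    (Prog.forTo a i e P).Spec (b * (T + e.cost + 11) + e.cost + 8) m
      fun m' => m'.nat a i = b ∧ Inv b m' := by
  have main : ∀ d k m', d + k = b → m'.nat a i = k → Inv k m' →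
      (Prog.loop (.not (.natLe e (.get a (.lit i))))
        (.seq P (.setNat a (.lit i) (.add (.get a (.lit i)) (.lit 1))))).Spec
        (d * (T + e.cost + 11) + e.cost + 5) m' fun m' => m'.nat a i = b ∧ Inv b m' := by
    intro d
    induction d with
    | zero =>
      intro k m' hk hc hI
      have hkb : k = b := by omega
      subst hkb
      refine ⟨m', _, .loop_false ?_, ?_, hc, hI⟩
      · simp [BoolExpr.holds, hb k m' hc hI, NatExpr.eval, hc]
      · simp [BoolExpr.cost, NatExpr.cost]
    | succ d ih =>
      intro k m' hk hc hI
      obtain ⟨m1, t1, r1, l1, c1, i1⟩ := hstep k (by omega) m' hc hI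
      obtain ⟨m2, t2, r2, l2, q2⟩ := ih (k + 1) (m1.setNat a i (k + 1)) (by omega) (by simp) i1
      have r3 : (Prog.setNat a (.lit i) (.add (.get a (.lit i)) (.lit 1))).Run m1
          (m1.setNat a i (k + 1)) 6 := by
        have := Run.setNat m1 a (.lit i) (.add (.get a (.lit i)) (.lit 1))
        simpa [NatExpr.eval, c1, NatExpr.cost] using this
      refine ⟨m2, _, .loop_true ?_ (.seq r1 r3) r2, ?_, q2⟩
      · simp [BoolExpr.holds, hb k m' hc hI, NatExpr.eval, hc]; omega
      · simp [BoolExpr.cost, NatExpr.cost]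
        have : (d + 1) * (T + e.cost + 11) = d * (T + e.cost + 11) + (T + e.cost + 11) := by ring
        omega
  have h1 : (Prog.setNat a (.lit i) (.lit 0)).Spec 3 m (fun m' => m' = m.setNat a i 0) :=
    Spec.setNat rfl
  refine (h1.seq (T' := b * (T + e.cost + 11) + e.cost + 5)
    (Q' := fun m' => m'.nat a i = b ∧ Inv b m') ?_).mono (by omega) fun _ h => h
  rintro _ rfl
  exact main b 0 _ rfl (by simp) h0

end Prog

/-! ### Copying, swapping and sorting

Names of the arrays of natural numbers: `0` input (`n` and `K`), `1` best assignment so far, `2` products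
sorted by weight, `3` codes, `4` assignment under construction, `5` number of products placed in it,
`6` and `7` counters for the codes and their repetitions, `8` counter for swaps, `9` temporary value,
`10` running index into the reservation prices, `11` flag of a customer who has stopped, `12` and `13`
counters for segments and positions, `14` and `15` counters for sorting, `16` counter for copying.

Names of the arrays of real numbers: `0`, `1`, `2` input, `3` best share so far, `4` share of the
assignment under construction, `5` weight inspected by the current customer. -/

/-- The array `a` of natural numbers holds the values of the permutation `π`. -/
def Mem.Holds (m : Mem) {n : ℕ} (a : ℕ) (π : Equiv.Perm (Fin n)) : Prop :=
  ∀ p : Fin n, m.nat a p = (π p : ℕ)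

/-- The register named `a`: cell `0` of the array of natural numbers `a`. -/
abbrev NatExpr.reg (a : ℕ) : NatExpr := .get a (.lit 0)

/-- The register named `a`: cell `0` of the array of real numbers `a`. -/
abbrev RealExpr.reg (a : ℕ) : RealExpr := .get a (.lit 0)

namespace Prog

/-- Copies the first `n` cells of the array `src` of natural numbers to `dst`. -/
def copy (src dst : ℕ) : Prog :=
  forTo 16 0 (.reg 0) (.setNat dst (.reg 16) (.get src (.reg 16)))

theorem copy_spec {src dst n : ℕ} {m : Mem} (h1 : src ≠ dst) (h2 : src ≠ 16) (h3 : dst ≠ 16)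
    (h4 : dst ≠ 0) (hn : m.nat 0 0 = n) :
    (copy src dst).Spec (20 * n + 10) m fun m' => ∀ i < n, m'.nat dst i = m.nat src i := by
  refine (Spec.forTo (b := n) (T := 6)
    (fun k m' => m'.nat 0 = m.nat 0 ∧ m'.nat src = m.nat src ∧ ∀ i < k, m'.nat dst i = m.nat src i)
    ?_ ?_ ?_).mono ?_ ?_
  · simp [h2]
  · rintro k m' - ⟨h, -⟩
    simp [NatExpr.eval, h, hn]
  · rintro k hk m' hc ⟨i1, i2, i3⟩
    refine (Spec.setNat ?_).mono (by simp [NatExpr.cost]) fun _ h => h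
    simp only [NatExpr.eval, hc]
    refine ⟨by simp [h3.symm, hc], by simp [h4.symm, i1], by simp [h1, h2, i2], ?_⟩
    intro i hi
    rw [Mem.nat_setNat_of_ne _ _ _ h3, Mem.nat_setNat_self, Function.update_apply, i2]
    split_ifs with h
    · rw [h]
    · exact i3 i (by omega)
  · simp [NatExpr.cost]; omega
  · exact fun m' h => h.2.2.2

/-- Exchanges the cells `x` and `y` of the array `arr` of natural numbers. -/
def swap (arr : ℕ) (x y : NatExpr) : Prog :=
  .seq (.setNat 9 (.lit 0) (.get arr x))
    (.seq (.setNat arr x (.get arr y)) (.setNat arr y (.reg 9)))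

/-- The expressions `x` and `y` are evaluated again between the writes, hence the hypotheses that they do
not depend on `arr` and on the temporary array. -/
theorem swap_spec {arr i j : ℕ} {x y : NatExpr} {m : Mem} (harr : arr ≠ 9)
    (hx : ∀ m' : Mem, (∀ a, a ≠ arr → a ≠ 9 → m'.nat a = m.nat a) → x.eval m' = i)
    (hy : ∀ m' : Mem, (∀ a, a ≠ arr → a ≠ 9 → m'.nat a = m.nat a) → y.eval m' = j) :
    (swap arr x y).Spec (2 * x.cost + 2 * y.cost + 8) m fun m' =>
      m'.nat arr = Function.update (Function.update (m.nat arr) i (m.nat arr j)) j (m.nat arr i) := by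
  have h1 : (Prog.setNat 9 (.lit 0) (.get arr x)).Spec (x.cost + 3) m
      (fun m' => m' = m.setNat 9 0 (m.nat arr i)) :=
    (Spec.setNat (by rw [NatExpr.eval, NatExpr.eval, hx m fun _ _ _ => rfl])).mono
      (by simp [NatExpr.cost]; omega) fun _ h => h
  refine (h1.seq (T' := x.cost + 2 * y.cost + 5) (Q' := fun m' =>
      m'.nat arr = Function.update (Function.update (m.nat arr) i (m.nat arr j)) j (m.nat arr i))
      ?_).mono (by omega) fun _ h => h
  rintro _ rfl
  have h2 : (Prog.setNat arr x (.get arr y)).Spec (x.cost + y.cost + 2) (m.setNat 9 0 (m.nat arr i))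
      (fun m' => m' = (m.setNat 9 0 (m.nat arr i)).setNat arr i (m.nat arr j)) := by
    refine (Spec.setNat ?_).mono (by simp [NatExpr.cost]; omega) fun _ h => h
    rw [NatExpr.eval, hx _ fun a _ ha => by simp [ha], hy _ fun a _ ha => by simp [ha]]
    simp [harr]
  refine (h2.seq (T' := y.cost + 3) (Q' := fun m' =>
      m'.nat arr = Function.update (Function.update (m.nat arr) i (m.nat arr j)) j (m.nat arr i))
      ?_).mono (by omega) fun _ h => h
  rintro _ rfl
  refine (Spec.setNat ?_).mono (by simp [NatExpr.cost]) fun _ h => h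
  rw [hy _ fun a h1 h2 => by simp [h1, h2]]
  simp [NatExpr.eval, harr, harr.symm]

end Prog

theorem holds_update {n : ℕ} {f g : ℕ → ℕ} {π : Equiv.Perm (Fin n)} (h : ∀ p : Fin n, f p = (π p : ℕ))
    (i j : Fin n) (hg : g = Function.update (Function.update f i (f j)) j (f i)) (p : Fin n) :
    g p = ((π * Equiv.swap i j) p : ℕ) := by
  subst hg
  rw [Equiv.Perm.mul_apply, Function.update_apply, Function.update_apply]
  by_cases hj : p = j
  · subst hj; simp [h]
  by_cases hi : p = i
  · subst hi; simp [h, Fin.val_ne_of_ne hj]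
  · rw [Equiv.swap_apply_of_ne_of_ne hi hj]
    simp [h, Fin.val_ne_of_ne hj, Fin.val_ne_of_ne hi]

namespace Prog

/-- Sorts the products in array `2` by decreasing weight, by exchange sort. -/
def sort : Prog :=
  forTo 14 0 (.reg 0) (forTo 15 0 (.reg 0)
    (.ite (.and (.not (.natLe (.reg 15) (.reg 14)))
        (.not (.realLe (.get 0 (.get 2 (.reg 15))) (.get 0 (.get 2 (.reg 14))))))
      (swap 2 (.reg 14) (.reg 15)) .skip))

theorem sort_spec (I : Market) {m : Mem} {π : Equiv.Perm (Fin I.n)} (hn : m.nat 0 0 = I.n)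
    (hw : m.real 0 = I.input.real 0) (hπ : m.Holds 2 π) :
    sort.Spec (I.n * (I.n * 100 + 100) + 10) m fun m' => ∃ σ : I.Assignment, m'.Holds 2 σ ∧
      (I.weightList σ).Pairwise (· ≥ ·) := by
  have hreal : ∀ p : Fin I.n, I.input.real 0 p = I.w p := by
    intro p; simp [Market.input]
  refine (Spec.forTo (b := I.n) (T := I.n * 60 + 10)
    (fun i m' => m'.nat 0 = m.nat 0 ∧ m'.real 0 = m.real 0 ∧ ∃ σ : I.Assignment, m'.Holds 2 σ ∧
      ∀ p q : Fin I.n, p < i → p < q → I.w (σ q) ≤ I.w (σ p)) ?_ ?_ ?_).mono ?_ ?_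
  · refine ⟨by simp, by simp, π, ?_, by simp⟩
    intro p; simpa using hπ p
  · rintro k m' - ⟨h, -⟩
    simp [NatExpr.eval, h, hn]
  · rintro i hi m₁ hc ⟨i1, i2, σ, i3, i4⟩
    refine (Spec.forTo (b := I.n) (T := 40)
      (fun j m' => m'.nat 0 = m.nat 0 ∧ m'.real 0 = m.real 0 ∧ m'.nat 14 0 = i ∧
        ∃ σ : I.Assignment, m'.Holds 2 σ ∧
        (∀ p q : Fin I.n, p < i → p < q → I.w (σ q) ≤ I.w (σ p)) ∧
        (∀ q : Fin I.n, i < q → q < j → I.w (σ q) ≤ I.w (σ ⟨i, hi⟩))) ?_ ?_ ?_).mono ?_ ?_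
    · refine ⟨by simp [i1], by simp [i2], by simp [hc], σ, ?_, i4, by simp⟩
      intro p; simpa using i3 p
    · rintro k m' - ⟨h, -⟩
      simp [NatExpr.eval, h, hn]
    · rintro j hj m₂ hc₂ ⟨j1, j2, j3, σ, j4, j5, j6⟩
      have e14 : m₂.nat 2 i = σ ⟨i, hi⟩ := j4 ⟨i, hi⟩
      have e15 : m₂.nat 2 j = σ ⟨j, hj⟩ := j4 ⟨j, hj⟩
      refine (Spec.ite (T := 18) (fun hb => ?_) (fun hb => ?_)).mono
        (by simp [BoolExpr.cost, RealExpr.cost, NatExpr.cost]) fun _ h => h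
      · simp only [BoolExpr.holds, NatExpr.eval, RealExpr.eval, j3, hc₂, e14, e15, j2, hw, hreal,
          not_le] at hb
        have hs := swap_spec (arr := 2) (i := i) (j := j) (x := .reg 14) (y := .reg 15) (m := m₂)
          (by simp)
          (fun m' h => by simp [NatExpr.eval, h, j3]) (fun m' h => by simp [NatExpr.eval, h, hc₂])
        refine hs.frame.mono (by simp [NatExpr.cost]) ?_
        rintro m₃ ⟨h1, h2, h3⟩
        simp only [natWrites, realWrites, swap] at h2 h3
        have h4 := holds_update j4 ⟨i, hi⟩ ⟨j, hj⟩ h1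
        refine ⟨by rw [h2 15 (by simp), hc₂], by simp [h2, j1], by simp [h3, j2],
          by simp [h2, j3], σ * Equiv.swap ⟨i, hi⟩ ⟨j, hj⟩, fun p => by simpa using h4 p, ?_, ?_⟩
        · intro p q hp hpq
          have hpi : p ≠ ⟨i, hi⟩ := fun h => by simp [h] at hp
          have hpj : p ≠ ⟨j, hj⟩ := fun h => by simp [h] at hp; omega
          rw [Equiv.Perm.mul_apply, Equiv.Perm.mul_apply, Equiv.swap_apply_of_ne_of_ne hpi hpj]
          refine j5 p _ hp ?_
          by_cases hqi : q = ⟨i, hi⟩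
          · rw [hqi, Equiv.swap_apply_left]; exact Fin.lt_def.2 (by simp; omega)
          by_cases hqj : q = ⟨j, hj⟩
          · rw [hqj, Equiv.swap_apply_right]; exact Fin.lt_def.2 (by simp; omega)
          rwa [Equiv.swap_apply_of_ne_of_ne hqi hqj]
        · intro q hq hqj
          simp only [Equiv.Perm.mul_apply, Equiv.swap_apply_left]
          by_cases hq' : q = ⟨j, hj⟩
          · rw [hq', Equiv.swap_apply_right]; exact hb.2.le
          · have hqi : q ≠ ⟨i, hi⟩ := fun h => by simp [h] at hq
            rw [Equiv.swap_apply_of_ne_of_ne hqi hq']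
            have : (q : ℕ) ≠ j := fun h => hq' (Fin.ext h)
            exact (j6 q hq (by omega)).trans hb.2.le
      · simp only [BoolExpr.holds, NatExpr.eval, RealExpr.eval, j3, hc₂, e14, e15, j2, hw, hreal,
          not_and, not_le, not_lt] at hb
        refine (Spec.skip ?_).mono (by simp) fun _ h => h
        refine ⟨hc₂, by simp [j1], by simp [j2], by simp [j3], σ, fun p => by simpa using j4 p, j5, ?_⟩
        intro q hq hqj
        rcases Nat.lt_succ_iff_lt_or_eq.1 hqj with h | h
        · exact j6 q hq h
        · have := hb (by omega)
          rwa [show q = ⟨j, hj⟩ from Fin.ext h]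
    · simp [NatExpr.cost]; omega
    · rintro m₂ ⟨-, j1, j2, j3, σ, j4, j5, j6⟩
      refine ⟨j3, by simp [j1], by simp [j2], σ, fun p => by simpa using j4 p, ?_⟩
      intro p q hp hpq
      rcases Nat.lt_succ_iff_lt_or_eq.1 hp with h | h
      · exact j5 p q h hpq
      · rw [show p = ⟨i, hi⟩ from Fin.ext h]
        exact j6 q (by rw [← h]; exact hpq) q.2
  · simp [NatExpr.cost]; nlinarith
  · rintro m' ⟨-, -, -, σ, h1, h2⟩
    refine ⟨σ, h1, ?_⟩
    rw [Market.weightList, List.pairwise_ofFn]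
    intro p q hpq
    exact h2 p q p.2 hpq

end Prog

/-! ### Executing codes -/

theorem extract_of_length_le {a : ℕ} {s : List ℝ × List ℝ} (h : s.2.length ≤ a) : extract a s = s := by
  simp [extract, List.eraseIdx_of_length_le h, List.getElem?_eq_none h]

/-- In a single array holding the placed elements followed by the remaining ones, extraction is a cyclic
shift of the cells from `s.1.length` to `s.1.length + a`. -/
theorem map_range_extract {n a : ℕ} {x y : ℕ → ℝ} {s : List ℝ × List ℝ}
    (hx : (List.range n).map x = s.1 ++ s.2) (ha : s.1.length + a < n)
    (hy : ∀ q, y q = if q < s.1.length then x q else if q = s.1.length then x (s.1.length + a)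
      else if q ≤ s.1.length + a then x (q - 1) else x q) :
    (List.range n).map y = (extract a s).1 ++ (extract a s).2 := by
  have hlen : s.1.length + s.2.length = n := by
    have := congrArg List.length hx
    simpa using this.symm
  have ha2 : a < s.2.length := by omega
  have h1 : ∀ q (h : q < s.1.length), x q = s.1[q] := by
    intro q h
    have := List.getElem_of_eq hx (i := q) (by simp; omega)
    rwa [List.getElem_map, List.getElem_range, List.getElem_append_left h] at this
  have h2 : ∀ q (h : q < s.2.length), x (s.1.length + q) = s.2[q] := by
    intro q h
    have := List.getElem_of_eq hx (i := s.1.length + q) (by simp; omega)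
    rw [List.getElem_map, List.getElem_range, List.getElem_append_right (by omega)] at this
    simpa using this
  apply List.ext_getElem
  · simp [extract, ha2, List.length_eraseIdx_of_lt]; omega
  intro q hq hq'
  simp only [List.length_map, List.length_range] at hq
  simp only [List.getElem_map, List.getElem_range, extract, List.getElem?_eq_getElem ha2,
    Option.toList_some, List.append_assoc, List.singleton_append]
  rw [hy]
  rcases lt_trichotomy q s.1.length with h | h | h
  · rw [if_pos h, h1 q h, List.getElem_append_left h]
  · subst h
    simp [h2 a ha2]
  · obtain ⟨k, rfl⟩ : ∃ k, q = s.1.length + (k + 1) := ⟨q - s.1.length - 1, by omega⟩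
    rw [if_neg (by omega), if_neg (by omega), List.getElem_append_right (by omega)]
    simp only [Nat.add_sub_cancel_left, List.getElem_cons_succ]
    rw [List.getElem_eraseIdx]
    by_cases hk : k < a
    · rw [if_pos (by omega), dif_pos hk, ← h2 k (by omega)]
      congr 1
    · rw [if_neg (by omega), dif_neg hk, ← h2 (k + 1) (by omega)]

namespace Market

theorem input_real_weight (I : Market) (p : Fin I.n) : I.input.real 0 p = I.w p := by
  simp [input]

theorem weightList_eq_map (I : Market) {m : Mem} {a : ℕ} {π : I.Assignment}
    (hw : m.real 0 = I.input.real 0) (h : m.Holds a π) :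
    I.weightList π = (List.range I.n).map fun q => m.real 0 (m.nat a q) := by
  apply List.ext_getElem
  · simp [weightList]
  intro q hq hq'
  rw [length_weightList] at hq
  have := h ⟨q, hq⟩
  simp only at this
  simp [weightList, this, hw, input_real_weight]

/-- The arrays `4` and `5` represent the state `s`: the assignment under construction lists the placed
products and then the remaining ones. -/
def Represents (I : Market) (m : Mem) (s : List ℝ × List ℝ) : Prop :=
  ∃ π : I.Assignment, m.Holds 4 π ∧ I.weightList π = s.1 ++ s.2 ∧ m.nat 5 0 = s.1.length

end Market

namespace Prog

/-- The index `a` of the current code `(m, a)`. The first components of the `N` codes are stored in the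
cells `0, …, N - 1` of array `3`, the second components in the cells `N, …, 2 * N - 1`. -/
def startExpr (N : ℕ) : NatExpr := .get 3 (.add (.lit N) (.reg 6))

/-- Implements `extract`. Exchanging the cell to be moved with the cells before it, in increasing order,
shifts these cells by one. -/
def pull (N : ℕ) : Prog :=
  .ite (.not (.natLe (.reg 0) (.add (.reg 5) (startExpr N))))
    (.seq (forTo 8 0 (startExpr N)
        (swap 4 (.add (.reg 5) (.reg 8)) (.add (.reg 5) (startExpr N))))
      (.setNat 5 (.lit 0) (.add (.reg 5) (.lit 1))))
    .skip

theorem pull_spec (I : Market) {N j : ℕ} {m : Mem} {s : List ℝ × List ℝ}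
    (hn : m.nat 0 0 = I.n) (hw : m.real 0 = I.input.real 0) (hj : m.nat 6 0 = j)
    (hs : I.Represents m s) :
    (pull N).Spec (50 * I.n + 40) m fun m' => I.Represents m' (extract (m.nat 3 (N + j)) s) := by
  obtain ⟨π, h1, h2, h3⟩ := hs
  have hlen : s.1.length + s.2.length = I.n := by
    rw [← List.length_append, ← h2, I.length_weightList]
  set a := m.nat 3 (N + j) with ha
  set c := s.1.length with hc
  refine (Spec.ite (T := 50 * I.n + 20) (fun hb => ?_) (fun hb => ?_)).mono
    (by simp [BoolExpr.cost, NatExpr.cost, startExpr]; omega) fun _ h => h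
  · simp only [BoolExpr.holds, NatExpr.eval, hn, startExpr, hj, h3, ← ha, not_le] at hb
    -- `F i` is the contents of the array after `i` exchanges.
    set F : ℕ → ℕ → ℕ := fun i q => if q < c then m.nat 4 q else if q < c + i then
      (if q = c then m.nat 4 (c + a) else m.nat 4 (q - 1)) else if q = c + a then
      (if i = 0 then m.nat 4 (c + a) else m.nat 4 (c + i - 1)) else m.nat 4 q with hF
    refine (Spec.seq (T := a * 50 + 13) (Q := fun m' => m'.nat 4 = F a ∧ m'.nat 5 0 = c ∧
      m'.real 0 = m.real 0 ∧ ∃ ρ : I.Assignment, m'.Holds 4 ρ)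
      ((Spec.forTo (b := a) (T := 34) (fun i m' => m'.nat 0 = m.nat 0 ∧ m'.nat 3 = m.nat 3 ∧
        m'.nat 5 = m.nat 5 ∧ m'.nat 6 = m.nat 6 ∧ m'.real 0 = m.real 0 ∧ m'.nat 4 = F i ∧
        ∃ ρ : I.Assignment, m'.Holds 4 ρ) ?_ ?_ ?_).mono ?_ ?_)
        (fun m₁ h => (Spec.setNat (Q := fun m' =>
          I.Represents m' (extract a s)) ?_).mono (T' := 6) ?_ fun _ h => h)).mono
        ?_ fun _ h => h
    · refine ⟨by simp, by simp, by simp, by simp, by simp, ?_, π, fun p => by simpa using h1 p⟩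
      funext q
      simp only [Mem.nat_setNat_of_ne _ _ _ (show 4 ≠ 8 by decide), hF]
      grind
    · rintro k m' - ⟨-, i2, -, i4, -⟩
      simp [startExpr, NatExpr.eval, i2, i4, hj, ha]
    · rintro i hi m₁ hci ⟨i1, i2, i3, i4, i5, i6, ρ, i7⟩
      have hsw := swap_spec (arr := 4) (i := c + i) (j := c + a) (x := .add (.reg 5) (.reg 8))
        (y := .add (.reg 5) (startExpr N)) (m := m₁) (by simp)
        (fun m' h => by simp [NatExpr.eval, h, i3, h3, hci])
        (fun m' h => by simp [NatExpr.eval, startExpr, h, i2, i3, i4, h3, hj, ha])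
      refine hsw.frame.mono (by simp [NatExpr.cost, startExpr]) ?_
      rintro m₂ ⟨f1, f2, f3⟩
      simp only [natWrites, realWrites, swap] at f2 f3
      have hρ := holds_update i7 ⟨c + i, by omega⟩ ⟨c + a, hb⟩ f1
      refine ⟨by rw [f2 8 (by simp), hci], by simp [f2, i1], by simp [f2, i2], by simp [f2, i3],
        by simp [f2, i4], by simp [f3, i5], ?_, _, fun p => (by
          rw [Mem.nat_setNat_of_ne _ _ _ (by decide)]; exact hρ p)⟩
      rw [Mem.nat_setNat_of_ne _ _ _ (by decide), f1, i6]
      funext q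
      simp only [Function.update_apply, hF]
      grind
    · simp [NatExpr.cost, startExpr]
    · rintro m' ⟨-, -, -, i3, -, i5, i6, i7⟩
      exact ⟨i6, by rw [i3, h3], i5, i7⟩
    · obtain ⟨g1, g2, g3, ρ, g4⟩ := h
      refine ⟨ρ, fun p => by simpa using g4 p, ?_, ?_⟩
      · rw [I.weightList_eq_map (g3.trans hw) g4]
        rw [I.weightList_eq_map hw h1] at h2
        refine map_range_extract h2 hb fun q => ?_
        rw [g1, g3, ← hc]
        simp only [hF]
        grind
      · have ha2 : a < s.2.length := by omega
        simp [NatExpr.eval, g2, extract, ha2, hc]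
    · simp [NatExpr.cost]
    · have : a * 50 ≤ 50 * I.n := by omega
      omega
  · simp only [BoolExpr.holds, NatExpr.eval, hn, startExpr, hj, h3, ← ha, not_not] at hb
    refine (Spec.skip ?_).mono (by omega) fun _ h => h
    rw [extract_of_length_le (by omega)]
    exact ⟨π, h1, h2, h3⟩

/-- Implements `arrange`. -/
def decode (N : ℕ) : Prog :=
  forTo 6 0 (.lit N) (forTo 7 0 (.get 3 (.reg 6)) (pull N))

/-- The first `k` of the `N` codes stored in `f`. -/
def codes (N k : ℕ) (f : ℕ → ℕ) : List (ℕ × ℕ) := (List.range k).map fun j => (f j, f (N + j))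

theorem decode_spec (I : Market) {N : ℕ} {m : Mem} {s : List ℝ × List ℝ}
    (hn : m.nat 0 0 = I.n) (hw : m.real 0 = I.input.real 0) (hs : I.Represents m s)
    (hf : ∀ j < N, m.nat 3 j ≤ I.n) :
    (decode N).Spec (N * (I.n * (50 * I.n + 60) + 30) + 10) m fun m' =>
      I.Represents m' (arrange (codes N N (m.nat 3)) s) := by
  refine (Spec.forTo (b := N) (T := I.n * (50 * I.n + 54) + 11) (fun j m' => m'.nat 0 = m.nat 0 ∧
    m'.nat 3 = m.nat 3 ∧ m'.real 0 = m.real 0 ∧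
    I.Represents m' (arrange (codes N j (m.nat 3)) s)) ?_ ?_ ?_).mono ?_ ?_
  · refine ⟨by simp, by simp, by simp, ?_⟩
    obtain ⟨π, h1, h2, h3⟩ := hs
    exact ⟨π, fun p => by simpa using h1 p, by simpa [codes, arrange] using h2,
      by simpa [codes, arrange] using h3⟩
  · intros; rfl
  · rintro j hj m₁ hc ⟨i1, i2, i3, i4⟩
    set s₁ := arrange (codes N j (m.nat 3)) s with hs₁
    refine (Spec.forTo (b := m.nat 3 j) (T := 50 * I.n + 40) (fun t m' => m'.nat 0 = m.nat 0 ∧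
      m'.nat 3 = m.nat 3 ∧ m'.real 0 = m.real 0 ∧ m'.nat 6 0 = j ∧
      I.Represents m' ((extract (m.nat 3 (N + j)))^[t] s₁)) ?_ ?_ ?_).mono ?_ ?_
    · obtain ⟨π, h1, h2, h3⟩ := i4
      exact ⟨by simp [i1], by simp [i2], by simp [i3], by simp [hc], π,
        fun p => by simpa using h1 p, h2, by simpa using h3⟩
    · rintro t m' - ⟨-, k2, -, k4, -⟩
      simp [NatExpr.eval, k2, k4]
    · rintro t ht m₂ hct ⟨k1, k2, k3, k4, k5⟩
      refine (pull_spec I (N := N) (by rw [k1, hn]) (k3.trans hw) k4 k5).frame.mono le_rfl ?_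
      rintro m₃ ⟨⟨π, h1, h2, h3⟩, f2, f3⟩
      simp only [natWrites, realWrites, swap, pull, forTo] at f2 f3
      refine ⟨by rw [f2 7 (by simp), hct], by simp [f2, k1], by simp [f2, k2], by simp [f3, k3],
        by simp [f2, k4], ?_⟩
      rw [k2] at h2 h3
      rw [Function.iterate_succ_apply']
      exact ⟨π, fun p => by simpa using h1 p, h2, by simpa using h3⟩
    · have := hf j hj
      simp only [NatExpr.cost]
      have : m.nat 3 j * (50 * I.n + 40 + (1 + 1 + 1) + 11) ≤ I.n * (50 * I.n + 54) :=
        Nat.mul_le_mul this (by omega)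
      omega
    · rintro m₂ ⟨-, k1, k2, k3, k4, π, h1, h2, h3⟩
      refine ⟨k4, by simp [k1], by simp [k2], by simp [k3], ?_⟩
      have e : arrange (codes N (j + 1) (m.nat 3)) s =
          (extract (m.nat 3 (N + j)))^[m.nat 3 j] s₁ := by
        rw [codes, List.range_succ, List.map_append, List.map_singleton, arrange_append,
          arrange_cons, arrange_nil, hs₁, codes]
      rw [e]
      exact ⟨π, fun p => by simpa using h1 p, h2, by simpa using h3⟩
  · simp only [NatExpr.cost]
    nlinarith
  · exact fun m' h => h.2.2.2.2

end Prog

/-! ### Evaluating an assignment -/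

theorem StopsAt.unique {n : ℕ} {r : Fin n → ℝ} {l : List ℝ} {p q : Fin n}
    (hp : StopsAt n r l p) (hq : StopsAt n r l q) : p = q := by
  have key : ∀ {p q : Fin n}, StopsAt n r l p → StopsAt n r l q → ¬ p < q := by
    intro p q hp hq hlt
    rcases hp.le with h | h
    · exact absurd h (not_le.2 (hq.lt p hlt))
    · have := q.2
      have : (p : ℕ) < q := hlt
      omega
  exact le_antisymm (not_lt.1 (key hq hp)) (not_lt.1 (key hp hq))

namespace Market

theorem input_real_proportion (I : Market) (k : Fin I.K) : I.input.real 1 k = I.θ k := by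
  simp [input]

theorem input_real_price (I : Market) (k : Fin I.K) (p : Fin I.n) :
    I.input.real 2 (k * I.n + p) = I.r k p := by
  have h1 : ((k : ℕ) * I.n + p) / I.n = k := by
    rw [mul_comm, Nat.mul_add_div I.n_pos, Nat.div_eq_of_lt p.2, add_zero]
  have h2 : ((k : ℕ) * I.n + p) % I.n = p := by
    rw [mul_comm, Nat.mul_add_mod, Nat.mod_eq_of_lt p.2]
  simp only [input, if_neg (show (2 : ℕ) ≠ 0 by decide), if_neg (show (2 : ℕ) ≠ 1 by decide),
    if_true, h1, h2, dif_pos k.2]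

/-- The input is unchanged. -/
structure InputIntact (I : Market) (m : Mem) : Prop where
  nat : m.nat 0 = I.input.nat 0
  weight : m.real 0 = I.input.real 0
  proportion : m.real 1 = I.input.real 1
  price : m.real 2 = I.input.real 2

theorem InputIntact.nat_zero {I : Market} {m : Mem} (h : I.InputIntact m) : m.nat 0 0 = I.n := by
  rw [h.nat]; simp [input]

theorem InputIntact.nat_one {I : Market} {m : Mem} (h : I.InputIntact m) : m.nat 0 1 = I.K := by
  rw [h.nat]; simp [input]

theorem InputIntact.congr {I : Market} {m m' : Mem} (h : I.InputIntact m) (h0 : m'.nat 0 = m.nat 0)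
    (h1 : ∀ a < 3, m'.real a = m.real a) : I.InputIntact m' :=
  ⟨h0.trans h.nat, (h1 0 (by simp)).trans h.weight, (h1 1 (by simp)).trans h.proportion,
    (h1 2 (by simp)).trans h.price⟩

/-- A customer of segment `k` has walked along the first `p` positions of `A`: she either has not stopped
(flag `0`) or has stopped (flag `1`), and the weight she has inspected is recorded. -/
def Walked (I : Market) (k : Fin I.K) (A : I.Assignment) (p : ℕ) (m : Mem) : Prop :=
  (m.nat 11 0 = 0 ∧ m.real 5 0 = ((I.weightList A).take p).sum ∧
      ∀ q : Fin I.n, q < p → ((I.weightList A).take (q + 1)).sum < I.r k q) ∨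
    (m.nat 11 0 = 1 ∧ ∃ q : Fin I.n, StopsAt I.n (I.r k) (I.weightList A) q ∧
      m.real 5 0 = ((I.weightList A).take (q + 1)).sum)

theorem Walked.share_eq {I : Market} {k : Fin I.K} {A : I.Assignment} {m : Mem}
    (h : I.Walked k A I.n m) : m.real 5 0 / (1 + m.real 5 0) = I.segmentShare A k := by
  have hn := I.n_pos
  have hs := I.stopsAt_stopPos A k
  rw [segmentShare_eq]
  rcases h with ⟨-, h1, h2⟩ | ⟨-, q, h1, h2⟩
  · have hst : StopsAt I.n (I.r k) (I.weightList A) ⟨I.n - 1, by omega⟩ :=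
      ⟨fun q _ => h2 q q.2, Or.inr (by simp; omega)⟩
    rw [hs.unique hst, h1]
    simp only [show I.n - 1 + 1 = I.n by omega]
  · rw [hs.unique h1, h2]

end Market

namespace Prog

/-- A customer inspects one position. The index into the reservation prices also advances if she has
stopped before, so that it need not be computed by a multiplication. -/
def visit : Prog :=
  .seq (.ite (.natLe (.reg 11) (.lit 0))
      (.seq (.setReal 5 (.lit 0) (.add (.reg 5) (.get 0 (.get 4 (.reg 13)))))
        (.ite (.realLe (.get 2 (.reg 10)) (.reg 5)) (.setNat 11 (.lit 0) (.lit 1)) .skip))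
      .skip)
    (.setNat 10 (.lit 0) (.add (.reg 10) (.lit 1)))

theorem visit_spec (I : Market) {k : Fin I.K} {p : Fin I.n} {A : I.Assignment} {m : Mem}
    (hI : I.InputIntact m) (hA : m.Holds 4 A) (hp : m.nat 13 0 = p)
    (hidx : m.nat 10 0 = k * I.n + p) (h : I.Walked k A p m) :
    visit.Spec 40 m fun m' => I.Walked k A (p + 1) m' ∧ m'.nat 10 0 = k * I.n + (p + 1) := by
  have hsucc : ((I.weightList A).take (p + 1)).sum
      = ((I.weightList A).take p).sum + I.w (A p) := by
    rw [List.sum_take_succ _ _ (by rw [I.length_weightList]; exact p.2)]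
    simp [Market.weightList]
  refine (Spec.seq (T := 28) (Q := fun m' => I.Walked k A (p + 1) m' ∧ m'.nat 10 0 = k * I.n + p)
    ((Spec.ite (T := 22) (fun hb => ?_) (fun hb => ?_)).mono
      (by simp [BoolExpr.cost, NatExpr.cost]) fun _ h => h) fun m₁ ⟨h1, h2⟩ => ?_).mono
      (T := 28 + 6) (by simp) fun _ h => h
  · simp only [BoolExpr.holds, NatExpr.eval, Nat.le_zero] at hb
    obtain ⟨-, h1, h2⟩ := h.resolve_right fun h' => by omega
    refine (Spec.seq (T := 9) (Q := fun m' => m' = m.setReal 5 0 ((I.weightList A).take (p + 1)).sum)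
      ((Spec.setReal ?_).mono (by simp [RealExpr.cost, NatExpr.cost]) fun _ h => h) ?_).mono
      (T := 9 + 13) (by simp) fun _ h => h
    · have := hA p
      simp [NatExpr.eval, RealExpr.eval, h1, hp, this, hsucc, hI.weight, I.input_real_weight]
    · rintro m₂ rfl
      refine (Spec.ite (T := 4) (fun hc => ?_) (fun hc => ?_)).mono
        (by simp [BoolExpr.cost, RealExpr.cost, NatExpr.cost]) fun _ h => h
      · have hc : I.r k p ≤ ((I.weightList A).take (p + 1)).sum := by
          simpa [BoolExpr.holds, NatExpr.eval, RealExpr.eval, hidx, hI.price,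
            I.input_real_price] using hc
        refine (Spec.setNat ?_).mono (by simp [NatExpr.cost]) fun _ h => h
        exact ⟨Or.inr ⟨by simp [NatExpr.eval], p, ⟨h2, Or.inl hc⟩, by simp⟩, by simp [hidx]⟩
      · have hc : ((I.weightList A).take (p + 1)).sum < I.r k p := by
          simpa [BoolExpr.holds, NatExpr.eval, RealExpr.eval, hidx, hI.price,
            I.input_real_price] using hc
        refine (Spec.skip ?_).mono (by simp) fun _ h => h
        refine ⟨Or.inl ⟨by simpa using hb, by simp, fun q hq => ?_⟩, by simpa using hidx⟩
        rcases Nat.lt_succ_iff_lt_or_eq.1 hq with h | h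
        · exact h2 q h
        · rwa [show q = p from Fin.ext h]
  · simp only [BoolExpr.holds, NatExpr.eval, Nat.le_zero] at hb
    exact (Spec.skip ⟨Or.inr (h.resolve_left fun h' => hb h'.1), hidx⟩).mono (by simp) fun _ h => h
  · refine (Spec.setNat ?_).mono (by simp [NatExpr.cost]) fun _ h => h
    refine ⟨?_, by simp [NatExpr.eval, h2]; ring⟩
    simpa [Market.Walked] using h1

/-- Adds the contribution of one segment to the share. -/
def segment : Prog :=
  .seq (.setReal 5 (.lit 0) (.lit 0)) (.seq (.setNat 11 (.lit 0) (.lit 0))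
    (.seq (forTo 13 0 (.reg 0) visit)
      (.setReal 4 (.lit 0) (.add (.reg 4)
        (.mul (.get 1 (.reg 12)) (.div (.reg 5) (.add (.lit 1) (.reg 5))))))))

theorem segment_spec (I : Market) {k : Fin I.K} {A : I.Assignment} {m : Mem}
    (hI : I.InputIntact m) (hA : m.Holds 4 A) (hk : m.nat 12 0 = k)
    (hidx : m.nat 10 0 = k * I.n) :
    segment.Spec (54 * I.n + 40) m fun m' => m'.nat 10 0 = (k + 1) * I.n ∧
      m'.real 4 0 = m.real 4 0 + I.θ k * I.segmentShare A k := by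
  refine (Spec.seq (T := 3) (Q := fun m' => m' = m.setReal 5 0 0) ((Spec.setReal (by
    simp [RealExpr.eval, NatExpr.eval])).mono (by simp [RealExpr.cost, NatExpr.cost]) fun _ h => h)
    (T' := 54 * I.n + 37) ?_).mono (by omega) fun _ h => h
  rintro _ rfl
  refine (Spec.seq (T := 3) (Q := fun m' => m' = (m.setReal 5 0 0).setNat 11 0 0) ((Spec.setNat (by
    simp [NatExpr.eval])).mono (by simp [NatExpr.cost]) fun _ h => h)
    (T' := 54 * I.n + 34) ?_).mono (by omega) fun _ h => h
  rintro _ rfl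
  refine (Spec.seq (T := 54 * I.n + 10) (Q := fun m' => m'.nat 12 0 = k ∧ I.InputIntact m' ∧
      m'.real 4 = m.real 4 ∧ I.Walked k A I.n m' ∧ m'.nat 10 0 = k * I.n + I.n)
    (T' := 24) ((Spec.forTo (b := I.n) (T := 40) (fun p m' => m'.nat 12 0 = k ∧ I.InputIntact m' ∧
      m'.real 4 = m.real 4 ∧ I.Walked k A p m' ∧ m'.nat 10 0 = k * I.n + p ∧ m'.Holds 4 A)
      ?_ ?_ ?_).mono ?_ ?_) ?_).mono (by omega) fun _ h => h
  · refine ⟨by simp [hk], hI.congr (by simp) ?_, by simp, Or.inl ⟨by simp, by simp, by simp⟩,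
      by simp [hidx], fun p => by simpa using hA p⟩
    intro a ha
    simp [show a ≠ 5 by omega]
  · rintro p m' - ⟨-, h, -⟩
    exact h.nat_zero
  · rintro p hp m₁ hc ⟨i1, i2, i3, i4, i5, i6⟩
    refine (visit_spec I (p := ⟨p, hp⟩) i2 i6 hc i5 i4).frame.mono le_rfl ?_
    rintro m₂ ⟨⟨h1, h2⟩, f2, f3⟩
    simp only [natWrites, realWrites, visit] at f2 f3
    refine ⟨by rw [f2 13 (by simp), hc], by simp [f2, i1], i2.congr (by simp [f2]) ?_,
      by simp [f3, i3], by simpa [Market.Walked] using h1, by simpa using h2,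
      fun p => by simpa [f2] using i6 p⟩
    intro a ha
    simp [f3 a (by simp; omega)]
  · simp [NatExpr.cost]; omega
  · rintro m' ⟨-, h1, h2, h3, h4, h5, -⟩
    exact ⟨h1, h2, h3, h4, h5⟩
  · rintro m' ⟨h1, h2, h3, h4, h5⟩
    refine (Spec.setReal ?_).mono (by simp [NatExpr.cost, RealExpr.cost]) fun _ h => h
    refine ⟨by simp [h5]; ring, ?_⟩
    have := h4.share_eq
    simp [RealExpr.eval, NatExpr.eval, h1, h3, h2.proportion, I.input_real_proportion, this]

/-- Computes the share of the assignment in array `4`. -/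
def evaluate : Prog :=
  .seq (.setReal 4 (.lit 0) (.lit 0)) (.seq (.setNat 10 (.lit 0) (.lit 0))
    (forTo 12 0 (.get 0 (.lit 1)) segment))

theorem evaluate_spec (I : Market) {A : I.Assignment} {m : Mem}
    (hI : I.InputIntact m) (hA : m.Holds 4 A) :
    evaluate.Spec (I.K * (54 * I.n + 60) + 20) m fun m' => m'.real 4 0 = I.share A := by
  refine (Spec.seq (T := 3) (Q := fun m' => m' = m.setReal 4 0 0) ((Spec.setReal (by
    simp [RealExpr.eval, NatExpr.eval])).mono (by simp [RealExpr.cost, NatExpr.cost]) fun _ h => h)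
    (T' := I.K * (54 * I.n + 60) + 17) ?_).mono (by omega) fun _ h => h
  rintro _ rfl
  refine (Spec.seq (T := 3) (Q := fun m' => m' = (m.setReal 4 0 0).setNat 10 0 0) ((Spec.setNat (by
    simp [NatExpr.eval])).mono (by simp [NatExpr.cost]) fun _ h => h)
    (T' := I.K * (54 * I.n + 60) + 14) ?_).mono (by omega) fun _ h => h
  rintro _ rfl
  refine (Spec.forTo (b := I.K) (T := 54 * I.n + 40) (fun k m' => I.InputIntact m' ∧
    m'.Holds 4 A ∧ m'.nat 10 0 = k * I.n ∧
    m'.real 4 0 = ∑ i ∈ Finset.univ.filter (fun i : Fin I.K => (i : ℕ) < k), I.θ i * I.segmentShare A i) ?_ ?_ ?_).mono ?_ ?_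
  · refine ⟨hI.congr (by simp) ?_, fun p => by simpa using hA p, by simp, by simp⟩
    intro a ha
    simp [show a ≠ 4 by omega]
  · rintro p m' - ⟨h, -⟩
    exact h.nat_one
  · rintro k hk m₁ hc ⟨i1, i2, i3, i4⟩
    refine (segment_spec I (k := ⟨k, hk⟩) i1 i2 hc i3).frame.mono le_rfl ?_
    rintro m₂ ⟨⟨h1, h2⟩, f2, f3⟩
    simp only [natWrites, realWrites, visit, segment, forTo] at f2 f3
    refine ⟨by rw [f2 12 (by simp), hc], i1.congr (by simp [f2]) ?_,
      fun p => by simpa [f2] using i2 p, by simpa using h1, ?_⟩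
    · intro a ha
      simp [f3 a (by simp; omega)]
    · rw [Mem.real_setNat, h2, i4]
      have e : (Finset.univ.filter fun i : Fin I.K => (i : ℕ) < k + 1)
          = insert ⟨k, hk⟩ (Finset.univ.filter fun i : Fin I.K => (i : ℕ) < k) := by
        ext i
        simp [Fin.ext_iff]; omega
      rw [e, Finset.sum_insert (by simp), add_comm]
  · simp only [NatExpr.cost]
    have : 54 * I.n + 40 + (1 + 1) + 11 ≤ 54 * I.n + 60 := by omega
    have := Nat.mul_le_mul_left I.K this
    omega
  · rintro m' ⟨-, -, -, -, h⟩
    rw [h, Market.share]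
    congr 1
    exact Finset.filter_true_of_mem fun i _ => i.2

end Prog

/-! ### Searching through all codes -/

namespace Market

/-- The memory between two trials: array `2` holds the sorted products `σ`, and array `1` holds an
assignment whose share is at least the recorded value. -/
structure Ready (I : Market) (σ : I.Assignment) (m : Mem) : Prop where
  input : I.InputIntact m
  order : m.Holds 2 σ
  best : ∃ A : I.Assignment, m.Holds 1 A ∧ m.real 3 0 ≤ I.share A

end Market

namespace Prog

/-- Constructs and evaluates the assignment given by the codes in array `3`, and keeps it if it is better. -/
def trial (N : ℕ) : Prog :=
  .seq (copy 2 4) (.seq (.setNat 5 (.lit 0) (.lit 0)) (.seq (decode N) (.seq evaluate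
    (.ite (.not (.realLe (.reg 4) (.reg 3)))
      (.seq (copy 4 1) (.setReal 3 (.lit 0) (.reg 4))) .skip))))

/-- A bound for the number of operations of `trial`. -/
def trialCost (N n K : ℕ) : ℕ := N * (n * (50 * n + 60) + 30) + K * (54 * n + 60) + 40 * n + 100

/-- The assignment that results from the sorted products `σ` by the codes `f` has share at most `v`. -/
def ArrangedShareLe (I : Market) (N : ℕ) (σ : I.Assignment) (f : ℕ → ℕ) (v : ℝ) : Prop :=
  ∃ B : I.Assignment, I.weightList B = (arrange (codes N N f) ([], I.weightList σ)).1 ++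
    (arrange (codes N N f) ([], I.weightList σ)).2 ∧ I.share B ≤ v

theorem trial_spec (I : Market) {N : ℕ} {σ : I.Assignment} {m : Mem} (h : I.Ready σ m)
    (hf : ∀ j < N, m.nat 3 j ≤ I.n) :
    (trial N).Spec (trialCost N I.n I.K) m fun m' => I.Ready σ m' ∧ m.real 3 0 ≤ m'.real 3 0 ∧
      ArrangedShareLe I N σ (m.nat 3) (m'.real 3 0) := by
  obtain ⟨hI, hσ, A, hA, hbest⟩ := h
  have hn := hI.nat_zero
  refine (Spec.seq (T := 20 * I.n + 10) (T' := N * (I.n * (50 * I.n + 60) + 30) + 10 +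
    (I.K * (54 * I.n + 60) + 20) + (20 * I.n + 23) + 3) (Q := fun m' => m'.nat 0 = m.nat 0 ∧
      m'.nat 1 = m.nat 1 ∧ m'.nat 2 = m.nat 2 ∧ m'.nat 3 = m.nat 3 ∧ (∀ a, m'.real a = m.real a) ∧
      m'.Holds 4 σ) ((copy_spec (by decide) (by decide) (by decide) (by decide)
        hn).frame.mono le_rfl ?_) ?_).mono (by rw [trialCost]; omega) fun _ h => h
  · rintro m₁ ⟨h1, f2, f3⟩
    simp only [natWrites, realWrites, copy, forTo] at f2 f3
    refine ⟨f2 0 (by simp), f2 1 (by simp), f2 2 (by simp), f2 3 (by simp),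
      fun a => f3 a (by simp), fun p => (h1 p p.2).trans (hσ p)⟩
  rintro m₁ ⟨a0, a1, a2, a3, a4, a5⟩
  refine (Spec.seq (T := 3) (T' := N * (I.n * (50 * I.n + 60) + 30) + 10 +
    (I.K * (54 * I.n + 60) + 20) + (20 * I.n + 23)) (Q := fun m' => m' = m₁.setNat 5 0 0)
    ((Spec.setNat (by simp [NatExpr.eval])).mono (by simp [NatExpr.cost]) fun _ h => h)
    ?_).mono (by omega) fun _ h => h
  rintro _ rfl
  have hd := decode_spec I (N := N) (m := m₁.setNat 5 0 0) (s := ([], I.weightList σ))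
    (by simp [a0, hn]) (by simp [a4, hI.weight])
    ⟨σ, fun p => by simpa using a5 p, rfl, by simp⟩ (by simpa [a3] using hf)
  refine (Spec.seq (T' := (I.K * (54 * I.n + 60) + 20) + (20 * I.n + 23)) hd.frame ?_).mono
    (by omega) fun _ h => h
  rintro m₂ ⟨⟨B, b1, b2, -⟩, f2, f3⟩
  simp only [natWrites, realWrites, decode, pull, swap, forTo] at f2 f3
  simp only [Mem.nat_setNat_of_ne _ _ _ (show 3 ≠ 5 by decide), a3] at b2
  have hI2 : I.InputIntact m₂ := hI.congr (by simp [f2, a0]) (fun a _ => by simp [f3, a4])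
  refine (Spec.seq (T' := 20 * I.n + 23) (evaluate_spec I hI2 b1).frame ?_).mono
    (by omega) fun _ h => h
  rintro m₃ ⟨c1, g2, g3⟩
  simp only [natWrites, realWrites, evaluate, segment, visit, forTo] at g2 g3
  have hI3 : I.InputIntact m₃ :=
    hI2.congr (by simp [g2]) (fun a ha => g3 a (by simp; omega))
  have e1 : m₃.nat 1 = m.nat 1 := by simp [g2, f2, a1]
  have e2 : m₃.nat 2 = m.nat 2 := by simp [g2, f2, a2]
  have e3 : m₃.real 3 = m.real 3 := by simp [g3, f3, a4]
  have e4 : m₃.Holds 4 B := fun p => by rw [g2 4 (by simp)]; exact b1 p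
  refine (Spec.ite (T := 20 * I.n + 15) (fun hb => ?_) (fun hb => ?_)).mono
    (by simp [BoolExpr.cost, RealExpr.cost, NatExpr.cost]; omega) fun _ h => h
  · simp only [BoolExpr.holds, RealExpr.eval, NatExpr.eval, c1, e3, not_le] at hb
    refine (Spec.seq (T' := 4) (copy_spec (src := 4) (dst := 1) (by decide) (by decide) (by decide)
      (by decide) hI3.nat_zero).frame ?_).mono (by omega) fun _ h => h
    rintro m₄ ⟨d1, k2, k3⟩
    simp only [natWrites, realWrites, copy, forTo] at k2 k3
    refine (Spec.setReal ?_).mono (by simp [RealExpr.cost, NatExpr.cost]) fun _ h => h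
    have hv : (RealExpr.reg 4).eval m₄ = I.share B := by
      simp [RealExpr.eval, NatExpr.eval, k3, c1]
    rw [hv]
    refine ⟨⟨hI3.congr (by simp [k2]) ?_, fun p => ?_, B, fun p => ?_, by simp [NatExpr.eval]⟩,
      by simpa [NatExpr.eval] using hb.le, B, b2, by simp [NatExpr.eval]⟩
    · intro a ha
      simp [show a ≠ 3 by omega, k3]
    · simpa [k2, e2] using hσ p
    · simpa using (d1 p p.2).trans (e4 p)
  · simp only [BoolExpr.holds, RealExpr.eval, NatExpr.eval, c1, e3, not_not] at hb
    refine (Spec.skip ?_).mono (by omega) fun _ h => h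
    refine ⟨⟨hI3, fun p => by simpa [e2] using hσ p, A, fun p => by simpa [e1] using hA p,
      by rwa [e3]⟩, by rw [e3], B, b2, by rwa [e3]⟩

/-- Nested loops over all values from `0` to `n` of the code cells below `d`. -/
def search (N : ℕ) : ℕ → Prog
  | 0 => trial N
  | d + 1 => forTo 3 d (.add (.reg 0) (.lit 1)) (search N d)

theorem ArrangedShareLe.mono {I : Market} {N : ℕ} {σ : I.Assignment} {f : ℕ → ℕ} {v v' : ℝ}
    (h : ArrangedShareLe I N σ f v) (hv : v ≤ v') : ArrangedShareLe I N σ f v' := by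
  obtain ⟨B, h1, h2⟩ := h
  exact ⟨B, h1, h2.trans hv⟩

/-- The code cells below `d` may hold anything at the start; inner loops leave the value `n + 1` there. -/
theorem search_spec (I : Market) (N : ℕ) (σ : I.Assignment) (d : ℕ) (m : Mem) (h : I.Ready σ m)
    (hf : ∀ j ≥ d, m.nat 3 j ≤ I.n) :
    (search N d).Spec (trialCost N I.n I.K * (2 * I.n + 3) ^ d) m fun m' => I.Ready σ m' ∧
      (∀ j ≥ d, m'.nat 3 j = m.nat 3 j) ∧ m.real 3 0 ≤ m'.real 3 0 ∧
      ∀ f : ℕ → ℕ, (∀ j < d, f j ≤ I.n) → (∀ j ≥ d, f j = m.nat 3 j) →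
        ArrangedShareLe I N σ f (m'.real 3 0) := by
  induction d generalizing m with
  | zero =>
    refine (trial_spec I h fun j _ => hf j (Nat.zero_le j)).frame.mono (by simp) ?_
    rintro m' ⟨⟨h1, h2, h3⟩, f2, -⟩
    simp only [natWrites, trial, copy, decode, pull, swap, evaluate, segment, visit, forTo] at f2
    refine ⟨h1, fun j _ => by rw [f2 3 (by simp)], h2, fun f _ hf => ?_⟩
    rwa [show f = m.nat 3 from funext fun j => hf j (Nat.zero_le j)]
  | succ d ih =>
    set T := trialCost N I.n I.K * (2 * I.n + 3) ^ d with hT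
    have hT15 : 15 ≤ T := by
      calc 15 ≤ 100 * 1 := by norm_num
        _ ≤ T := Nat.mul_le_mul (by rw [trialCost]; omega) (Nat.one_le_pow _ _ (by omega))
    refine (Spec.forTo (b := I.n + 1) (T := T) (fun x m' => I.Ready σ m' ∧
      (∀ j ≥ d + 1, m'.nat 3 j = m.nat 3 j) ∧ m.real 3 0 ≤ m'.real 3 0 ∧
      ∀ f : ℕ → ℕ, (∀ j < d + 1, f j ≤ I.n) → (∀ j ≥ d + 1, f j = m.nat 3 j) → f d < x →
        ArrangedShareLe I N σ f (m'.real 3 0)) ?_ ?_ ?_).mono ?_ ?_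
    · obtain ⟨hI, hσ, A, hA, hb⟩ := h
      refine ⟨⟨hI.congr (by simp) (by simp), fun p => by simpa using hσ p, A,
        fun p => by simpa using hA p, hb⟩, fun j hj => ?_, by simp, by simp⟩
      simp [show j ≠ d by omega]
    · rintro x m' - ⟨h1, -⟩
      simp [NatExpr.eval, h1.input.nat_zero]
    · rintro x hx m₁ hc ⟨i1, i2, i3, i4⟩
      refine (ih m₁ i1 fun j hj => ?_).frame.mono le_rfl ?_
      · rcases hj.eq_or_lt with rfl | hj
        · omega
        · rw [i2 j hj]; exact hf j hj
      rintro m₂ ⟨⟨h1, h2, h3, h4⟩, -⟩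
      refine ⟨by rw [h2 d le_rfl, hc], ?_, fun j hj => ?_, ?_, fun f f1 f2 f3 => ?_⟩
      · obtain ⟨hI, hσ, A, hA, hb⟩ := h1
        exact ⟨hI.congr (by simp) (by simp), fun p => by simpa using hσ p, A,
          fun p => by simpa using hA p, hb⟩
      · simp [show j ≠ d by omega, h2 j (by omega), i2 j hj]
      · exact i3.trans h3
      · rcases Nat.lt_succ_iff_lt_or_eq.1 f3 with h | h
        · exact (i4 f f1 f2 h).mono h3
        · refine h4 f (fun j hj => f1 j (by omega)) fun j hj => ?_
          rcases hj.eq_or_lt with rfl | hj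
          · rw [h, hc]
          · rw [f2 j hj, i2 j hj]
    · simp only [NatExpr.cost]
      rw [pow_succ, ← mul_assoc, ← hT]
      nlinarith
    · rintro m' ⟨-, h1, h2, h3, h4⟩
      exact ⟨h1, h2, h3, fun f f1 f2 => h4 f f1 f2 (Nat.lt_succ_of_le (f1 d (by omega)))⟩

/-- The program with `N` codes. A market with one product is treated apart, as its running time must not
depend on `N`; there the output is correct from the beginning. -/
def program (N : ℕ) : Prog :=
  .ite (.natLe (.reg 0) (.lit 1)) .skip
    (.seq (forTo 16 0 (.reg 0) (.setNat 2 (.reg 16) (.reg 16)))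
      (.seq sort (.seq (copy 2 1) (.seq (.setReal 3 (.lit 0) (.lit (-1))) (search N (2 * N))))))

theorem program_spec (I : Market) (N : ℕ) (hn : 2 ≤ I.n) :
    (program N).Spec (I.n * (I.n * 100 + 100) + 100 * I.n + 100 +
      trialCost N I.n I.K * (2 * I.n + 3) ^ (2 * N)) I.input fun m' =>
      ∃ σ A : I.Assignment, (I.weightList σ).Pairwise (· ≥ ·) ∧ m'.Holds 1 A ∧
        ∀ f : ℕ → ℕ, (∀ j < 2 * N, f j ≤ I.n) → (∀ j ≥ 2 * N, f j = 0) →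
          ArrangedShareLe I N σ f (I.share A) := by
  have hI : I.InputIntact I.input := ⟨rfl, rfl, rfl, rfl⟩
  have hn0 := hI.nat_zero
  set S := trialCost N I.n I.K * (2 * I.n + 3) ^ (2 * N) with hS
  refine (Spec.ite (T := 40 * I.n + 30 + I.n * (I.n * 100 + 100) + 10 + S) (fun hb => ?_)
    (fun _ => ?_)).mono (by simp [BoolExpr.cost, NatExpr.cost]; omega) fun _ h => h
  · simp only [BoolExpr.holds, NatExpr.eval, hn0] at hb
    omega
  refine (Spec.seq (T := 20 * I.n + 10) (T' := 20 * I.n + 20 + I.n * (I.n * 100 + 100) + 10 + S)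
    (Q := fun m' => I.InputIntact m' ∧ m'.Holds 2 (1 : I.Assignment) ∧ m'.nat 3 = I.input.nat 3)
    ((Spec.forTo (b := I.n) (T := 5) (fun k m' => I.InputIntact m' ∧
      (∀ i < k, m'.nat 2 i = i) ∧ m'.nat 3 = I.input.nat 3) ?_ ?_ ?_).mono ?_ ?_) ?_).mono
    (by omega) fun _ h => h
  · exact ⟨hI.congr (by simp) (by simp), by simp, by simp⟩
  · rintro k m' - ⟨h, -⟩
    exact h.nat_zero
  · rintro k hk m₁ hc ⟨i1, i2, i3⟩
    refine (Spec.setNat ?_).mono (by simp [NatExpr.cost]) fun _ h => h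
    refine ⟨by simp [hc], i1.congr (by simp) (by simp), fun i hi => ?_, by simp [i3]⟩
    simp only [NatExpr.eval, hc, Mem.nat_setNat_of_ne _ _ _ (show 2 ≠ 16 by decide),
      Mem.nat_setNat_self, Function.update_apply]
    split_ifs with h
    · exact h.symm
    · exact i2 i (by omega)
  · simp [NatExpr.cost]; omega
  · rintro m' ⟨-, h1, h2, h3⟩
    exact ⟨h1, fun p => by simpa using h2 p p.2, h3⟩
  rintro m₁ ⟨h1, h2, h3⟩
  refine (Spec.seq (T' := 20 * I.n + 20 + S)
    (sort_spec I h1.nat_zero h1.weight h2).frame ?_).mono (by omega) fun _ h => h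
  rintro m₂ ⟨⟨σ, s1, s2⟩, f2, f3⟩
  simp only [natWrites, realWrites, sort, swap, forTo] at f2 f3
  have hI2 : I.InputIntact m₂ := h1.congr (by simp [f2]) (by simp [f3])
  refine (Spec.seq (T' := 4 + S) (copy_spec (src := 2) (dst := 1) (by decide) (by decide)
    (by decide) (by decide) hI2.nat_zero).frame ?_).mono (by omega) fun _ h => h
  rintro m₃ ⟨c1, g2, g3⟩
  simp only [natWrites, realWrites, copy, forTo] at g2 g3
  refine (Spec.seq (T := 3) (T' := S) (Q := fun m' => m' = m₃.setReal 3 0 (-1))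
    ((Spec.setReal (by simp [RealExpr.eval, NatExpr.eval])).mono
      (by simp [RealExpr.cost, NatExpr.cost]) fun _ h => h) ?_).mono (by omega) fun _ h => h
  rintro _ rfl
  have hz : ∀ j, (m₃.setReal 3 0 (-1)).nat 3 j = 0 := by
    intro j
    simp [g2, f2, h3, Market.input]
  refine (search_spec I N σ (2 * N) (m₃.setReal 3 0 (-1)) ⟨?_, ?_, σ, ?_, ?_⟩ ?_).mono le_rfl ?_
  · refine hI2.congr (by simp [g2]) fun a ha => ?_
    simp [show a ≠ 3 by omega, g3]
  · intro p; simpa [g2] using s1 p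
  · intro p; exact (c1 p p.2).trans (s1 p)
  · have := I.share_nonneg σ
    simp; linarith
  · intro j _; rw [hz]; exact Nat.zero_le _
  · rintro m' ⟨⟨-, -, A, hA, hb⟩, -, -, h⟩
    refine ⟨σ, A, s2, hA, fun f f1 f2 => (h f f1 fun j hj => ?_).mono hb⟩
    rw [f2 j hj, hz]

end Prog

/-! ### The running time -/

theorem codeCount_bounds {e : ℝ} (he : 0 < e) (he' : e ≤ 1) :
    1 ≤ codeCount e ∧ (codeCount e : ℝ) ≤ 24 / e ^ 4 := by
  have h1 : 1 ≤ 1 / e ^ 2 := by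
    rw [le_div_iff₀ (by positivity)]; nlinarith
  have h2 : (pairCount e : ℝ) ≤ 2 * (1 / e ^ 2) := by
    have := Nat.ceil_lt_add_one (show 0 ≤ 1 / e ^ 2 by positivity)
    unfold pairCount; linarith
  have h3 : (1 : ℝ) ≤ pairCount e := h1.trans (Nat.le_ceil _)
  have h4 : 1 ≤ pairCount e := by exact_mod_cast h3
  refine ⟨?_, ?_⟩
  · unfold codeCount; nlinarith
  · have e1 : 24 / e ^ 4 = 6 * (2 * (1 / e ^ 2)) ^ 2 := by field_simp; norm_num
    rw [e1, codeCount]; push_cast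
    have : (pairCount e : ℝ) ^ 2 ≤ (2 * (1 / e ^ 2)) ^ 2 := by gcongr
    nlinarith

theorem exponent_le {ε : ℝ} (hε : 0 < ε) :
    11 * (codeCount (min ε (1 / 2) / 6) : ℝ) ≤
      10 ^ 7 * max 1 ((1 / ε) ^ 6 * Real.log (1 / ε)) := by
  set x := min ε (1 / 2) with hx
  have hx0 : 0 < x := lt_min hε (by norm_num)
  have hx1 : x ≤ 1 / 2 := min_le_right _ _
  have h1 := (codeCount_bounds (e := x / 6) (by positivity) (by linarith)).2
  have h2 : 24 / (x / 6) ^ 4 = 31104 * (1 / x) ^ 4 := by field_simp; norm_num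
  rw [h2] at h1
  have h3 : (1 / x) ^ 4 ≤ 16 * max 1 ((1 / ε) ^ 6 * Real.log (1 / ε)) := by
    rcases le_total ε (1 / 2) with h | h
    · rw [hx, min_eq_left h]
      have hy : 2 ≤ 1 / ε := by rw [le_div_iff₀ hε]; linarith
      set y := 1 / ε with hydef
      have hlog : 1 / 2 ≤ Real.log y := by
        have := Real.log_le_log two_pos hy
        linarith [Real.log_two_gt_d9]
      have hy2 : 2 ≤ y ^ 2 := by nlinarith
      have : y ^ 4 ≤ y ^ 6 * Real.log y := by
        calc y ^ 4 = y ^ 4 * (2 * (1 / 2)) := by ring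
          _ ≤ y ^ 4 * (y ^ 2 * Real.log y) := by gcongr
          _ = y ^ 6 * Real.log y := by ring
      have h1 := le_max_right 1 (y ^ 6 * Real.log y)
      have h2 := le_max_left 1 (y ^ 6 * Real.log y)
      linarith
    · rw [hx, min_eq_right h]
      have := le_max_left 1 ((1 / ε) ^ 6 * Real.log (1 / ε))
      norm_num at this ⊢
  have h4 := le_max_left 1 ((1 / ε) ^ 6 * Real.log (1 / ε))
  linarith

/-- As `n ≥ 2`, the factor `N` is at most `n ^ N`. -/
theorem running_time_le {n K N : ℕ} (hn : 2 ≤ n) (hK : 1 ≤ K) (hN : 1 ≤ N) :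
    n * (n * 100 + 100) + 100 * n + 100 + Prog.trialCost N n K * (2 * n + 3) ^ (2 * N) ≤
      1000 * K * n ^ (11 * N) := by
  have h1 : Prog.trialCost N n K ≤ 500 * (N * K * n ^ 2) := by
    have a1 : n ≤ n ^ 2 := by nlinarith
    have a2 : 4 ≤ n ^ 2 := by nlinarith
    have a3 : 1 ≤ N * K := Nat.mul_pos hN hK
    have b1 : N * (n * (50 * n + 60) + 30) ≤ N * (140 * n ^ 2) :=
      Nat.mul_le_mul_left _ (by nlinarith)
    have b2 : K * (54 * n + 60) ≤ K * (114 * n ^ 2) := Nat.mul_le_mul_left _ (by nlinarith)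
    have b3 : N * n ^ 2 ≤ N * K * n ^ 2 := Nat.mul_le_mul_right _ (Nat.le_mul_of_pos_right _ hK)
    have b4 : K * n ^ 2 ≤ N * K * n ^ 2 := Nat.mul_le_mul_right _ (Nat.le_mul_of_pos_left _ hN)
    have b5 : n ^ 2 ≤ N * K * n ^ 2 := Nat.le_mul_of_pos_left _ a3
    unfold Prog.trialCost
    nlinarith
  have h2 : (2 * n + 3) ^ (2 * N) ≤ n ^ (8 * N) := by
    have : 2 * n + 3 ≤ n ^ 4 := by
      have : 4 ≤ n ^ 2 := by nlinarith
      nlinarith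
    calc (2 * n + 3) ^ (2 * N) ≤ (n ^ 4) ^ (2 * N) := Nat.pow_le_pow_left this _
      _ = n ^ (8 * N) := by rw [← pow_mul]; ring_nf
  have h3 : N ≤ n ^ N := (Nat.lt_pow_self (by omega)).le
  have h4 : Prog.trialCost N n K * (2 * n + 3) ^ (2 * N) ≤ 500 * K * n ^ (11 * N) := by
    calc Prog.trialCost N n K * (2 * n + 3) ^ (2 * N)
        ≤ 500 * (n ^ N * K * n ^ 2) * n ^ (8 * N) := by gcongr; exact h1.trans (by gcongr)
      _ = 500 * K * n ^ (9 * N + 2) := by ring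
      _ ≤ 500 * K * n ^ (11 * N) := by gcongr <;> omega
  have h5 : n * (n * 100 + 100) + 100 * n + 100 ≤ 500 * K * n ^ (11 * N) := by
    calc n * (n * 100 + 100) + 100 * n + 100 ≤ 500 * 1 * n ^ 2 := by nlinarith
      _ ≤ 500 * K * n ^ (11 * N) := by gcongr <;> omega
  linarith

namespace Market

theorem K_pos (I : Market) : 1 ≤ I.K := by
  by_contra h
  have h0 : I.K = 0 := by omega
  have : IsEmpty (Fin I.K) := by rw [h0]; infer_instance
  have := I.θ_sum
  simp at this

theorem computes_program_of_n_le_one (I : Market) (N : ℕ) (hn : I.n ≤ 1) (A : I.Assignment) :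
    I.Computes (Prog.program N) A 6 := by
  have h0 : (BoolExpr.natLe (.reg 0) (.lit 1)).holds I.input := by
    simpa [BoolExpr.holds, NatExpr.eval, input] using hn
  refine ⟨I.input, ?_, fun p => ?_⟩
  · exact Prog.Run.ite_true h0 (.skip _)
  · have := (A p).2
    simp [input]; omega

theorem exists_computes (I : Market) {e : ℝ} (he : 0 < e) (he' : e ≤ 1 / 6) (hn : 2 ≤ I.n) :
    ∃ (A : I.Assignment) (t : ℕ), I.Computes (Prog.program (codeCount e)) A t ∧
      (1 - 6 * e) * I.opt ≤ I.share A ∧ t ≤ 1000 * I.K * I.n ^ (11 * codeCount e) := by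
  set N := codeCount e with hN
  obtain ⟨m', t, hrun, ht, σ, A, hσ, hA, hbeats⟩ := Prog.program_spec I N hn
  refine ⟨A, t, ⟨m', hrun, hA⟩, ?_, ht.trans
    (running_time_le hn I.K_pos (codeCount_bounds he (by linarith)).1)⟩
  obtain ⟨cs, c1, c2, c3⟩ := I.exists_codes he he' σ hσ
  rw [← hN] at c1
  set f : ℕ → ℕ := fun j => if h : j < N then (cs[j]).1 else
    if h : j - N < N then (cs[j - N]).2 else 0 with hf
  have hcodes : Prog.codes N N f = cs := by
    refine List.ext_getElem (by simp [Prog.codes, c1]) fun j hj hj' => ?_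
    have hj : j < N := c1 ▸ hj'
    simp [Prog.codes, hf, hj]
  obtain ⟨B, b1, b2⟩ := hbeats f (fun j _ => by
    simp only [hf]
    split_ifs
    · exact (c2 _ (List.getElem_mem _)).1
    · exact (c2 _ (List.getElem_mem _)).2
    · exact Nat.zero_le _) (fun j hj => by
    simp only [hf]
    rw [dif_neg (by omega), dif_neg (by omega)])
  rw [hcodes] at b1
  exact (c3 B b1).trans b2

end Market

theorem theorem3 :
    ∃ C : ℝ, 0 < C ∧ ∀ ε : ℝ, 0 < ε → ∃ P : Prog, ∀ I : Market,
      ∃ (A : I.Assignment) (t : ℕ),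
        I.Computes P A t ∧
        (1 - ε) * I.opt ≤ I.share A ∧
        (t : ℝ) ≤ C * (I.K : ℝ) *
          (I.n : ℝ) ^ (C * max 1 ((1 / ε) ^ 6 * Real.log (1 / ε))) := by
  refine ⟨10 ^ 7, by norm_num, fun ε hε => ?_⟩
  set e := min ε (1 / 2) / 6 with he
  have he0 : 0 < e := div_pos (lt_min hε (by norm_num)) (by norm_num)
  have he1 : e ≤ 1 / 6 := by
    have := min_le_right ε (1 / 2)
    rw [he]; linarith
  have heε : 6 * e ≤ ε := by
    have := min_le_left ε (1 / 2)
    rw [he]; linarith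
  refine ⟨Prog.program (codeCount e), fun I => ?_⟩
  have hK : (1 : ℝ) ≤ I.K := by exact_mod_cast I.K_pos
  obtain ⟨A₀, hA₀⟩ := I.exists_share_eq_opt
  have hopt : 0 ≤ I.opt := hA₀ ▸ I.share_nonneg A₀
  rcases le_or_gt I.n 1 with hn | hn
  · refine ⟨A₀, 6, I.computes_program_of_n_le_one _ hn A₀, by rw [hA₀]; nlinarith, ?_⟩
    have : I.n = 1 := le_antisymm hn I.n_pos
    rw [this, Nat.cast_one, Real.one_rpow]
    push_cast; linarith
  · obtain ⟨A, t, h1, h2, h3⟩ := I.exists_computes he0 he1 hn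
    refine ⟨A, t, h1, le_trans (by nlinarith) h2, ?_⟩
    have hn1 : (1 : ℝ) ≤ I.n := by exact_mod_cast hn.le
    calc (t : ℝ) ≤ 1000 * I.K * (I.n : ℝ) ^ (11 * codeCount e) := by exact_mod_cast h3
      _ = 1000 * I.K * (I.n : ℝ) ^ (11 * (codeCount e : ℝ)) := by
          rw [← Real.rpow_natCast]; push_cast; rfl
      _ ≤ 10 ^ 7 * I.K * (I.n : ℝ) ^ (10 ^ 7 * max 1 ((1 / ε) ^ 6 * Real.log (1 / ε))) := by
          gcongr ?_ * _ * ?_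
          · norm_num
          · exact Real.rpow_le_rpow_of_exponent_le hn1 (exponent_le hε)
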